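/- **Setting.** Let $A\to M$ be a real smooth vector bundle of finite rank over a smooth manifold $M$, with dual bundle $A^*$, and let $E=A\oplus A^*$ carry the canonical form $\langle X+\xi,Y+\eta\rangle=\xi(Y)+\eta(X)$. Let $\mathcal A=\bigoplus_n\mathcal A^n$ be the graded algebra of functions on $T^*[2]A[1]$ with its canonical graded Poisson bracket $\{\ ,\ \}$ of degree $-2$; thus $\mathcal A^0=C^\infty(M)$, $\mathcal A^1=\Gamma E$, and $\{u,v\}=\langle u,v\rangle$ for $u,v\in\Gamma E$. A Courant algebroid structure on $(E,\langle\ ,\ \rangle)$ is an element $\Theta\in\mathcal A^3$ with $\{\Theta,\Theta\}=0$. A Lie algebroid structure $\mu$ on $A$, with anchor $\rho$ and bracket $[\ ,\ ]$, is identified with the element $\mu\in\mathcal A^3$ determined by $$\{\{X+\xi,\mu\},Y+\eta\}=[X,Y]+\mathcal L_X\eta-i_Y\mathrm d\xi,\qquad \{\{X+\xi,\mu\},f\}=\rho(X)\cdot f,$$ where $\mathcal L$ and $\mathrm d$ are the Lie derivative and the differential of $(A,\mu)$. A Lie algebroid structure $\gamma$ on $A^*$ is identified with an element $\gamma\in\mathcal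 A^3$ in the same way, with the roles of $A$ and $A^*$ exchanged. The same formulas assign an element of $\mathcal A^3$ to an anchor and bracket obtained by deformation as below. The pair $((A,\mu),(A^*,\gamma))$ is a Lie bialgebroid if $\mu$ and $\gamma$ are Lie algebroid structures and $\{\mu,\gamma\}=0$; its double is $A\oplus A^*$ with the Courant algebroid structure $\mu+\gamma$. For a vector bundle endomorphism $K$ of a Lie algebroid with anchor $\rho$ and bracket $[\ ,\ ]$, set $[X,Y]_K=[KX,Y]+[X,KY]-K[X,Y]$; the deformed structure consists of the bracket $[\ ,\ ]_K$ and the anchor $\rho\circ K$. The torsion of $K$ is $[KX,KY]-K[X,Y]_K$. The endomorphism $K$ is a cps structure if $K^2=\epsilon\,\mathrm{Id}$ with $\epsilon\in\{-1,1,0\}$ and its torsion vanishes. It is proportional to a cps structure if $K=cK_0$ with $c\in\mathbb R$ and $K_0$ a cps structure. **Theorem.** Let $((A,\mu),(A^*,\gamma))$ be a Lie bialgebroid and let $N:A\to A$ be a vector bundle endomorphism. Assume that $N$ is proportional to a cps structure on $(A,\mu)$ and that its transpose ${}^tN:A^*\to A^*$ is proportional to a cps structure on $(A^*,\gamma)$.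 Let $\mu_N$ be the deformation of $\mu$ by $N$, let $\gamma_{-{}^tN}$ be the deformation of $\gamma$ by $-{}^tN$, and let $\widetilde{\mathcal N}\in\mathcal A^2$ be the element with $\{X+\xi,\widetilde{\mathcal N}\}=NX-{}^tN\xi$ and $\{\widetilde{\mathcal N},f\}=0$ for $f\in C^\infty(M)$. Then: 1. $((A,\mu_N),(A^*,\gamma_{-{}^tN}))$ is a Lie bialgebroid; 2. $\mu_N=\{\widetilde{\mathcal N},\mu\}$ and $\gamma_{-{}^tN}=\{\widetilde{\mathcal N},\gamma\}$ in $\mathcal A^3$; 3. its double is the Courant algebroid $(A\oplus A^*,\{\widetilde{\mathcal N},\mu+\gamma\})$: that is, $\mu_N+\gamma_{-{}^tN}=\{\widetilde{\mathcal N},\mu+\gamma\}$, and $\{\widetilde{\mathcal N},\mu+\gamma\}$ is a Courant algebroid structure on $(A\oplus A^*,\langle\ ,\ \rangle)$. -/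

import Mathlib

open Bundle
open scoped Manifold ContDiff Bundle

noncomputable section

namespace LieBialgebroid

/-! ## The graded Poisson algebra of a vector bundle with a fibrewise metric

Let `R` be the algebra of functions and `E` the `R`-module of sections of a vector bundle with a
non-degenerate symmetric form `B`.  A function of degree `n` on the minimal symplectic realization
is determined by the functions in `R` obtained from it by taking iterated Poisson brackets, from
the right, with sections (which have degree `1`) and functions (which have degree `0`):
the function `φ` is encoded by
`[a₁, a₂, …, aₖ] ↦ {…{{φ, a₁}, a₂}, …, aₖ}`.
A bracket with a section lowers the degree by `1` and one with a function lowers it by `2`. -/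

section Algebra

variable {R E : Type*} [CommRing R] [Algebra ℝ R] [AddCommGroup E] [Module R E]

/-- Words in sections and functions. -/
abbrev Word (R E : Type*) := List (E ⊕ R)

/-- The amount by which iterated brackets with the letters of a word lower the degree. -/
def weight : Word R E → ℕ
  | [] => 0
  | Sum.inl _ :: w => weight w + 1
  | Sum.inr _ :: w => weight w + 2

/-- `φ` encodes an element of degree `n` of the graded Poisson algebra `𝒜` of `(E, B)`:
iterated brackets with sections and functions are `ℝ`-linear in each letter; the swapping rules
are the graded Jacobi identity together with `{u, v} = B u v`, `{u, f} = 0` and `{f, g} = 0`;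
the rules for the last letter are the Leibniz rule of the Poisson bracket. -/
structure IsOfDegree (B : LinearMap.BilinForm R E) (n : ℕ) (φ : Word R E → R) : Prop where
  eq_zero : ∀ w, weight w ≠ n → φ w = 0
  add_section : ∀ w w' u v,
    φ (w ++ Sum.inl (u + v) :: w') = φ (w ++ Sum.inl u :: w') + φ (w ++ Sum.inl v :: w')
  smul_section : ∀ w w' (c : ℝ) u,
    φ (w ++ Sum.inl (algebraMap ℝ R c • u) :: w') = c • φ (w ++ Sum.inl u :: w')
  add_function : ∀ w w' f g,
    φ (w ++ Sum.inr (f + g) :: w') = φ (w ++ Sum.inr f :: w') + φ (w ++ Sum.inr g :: w')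
  smul_function : ∀ w w' (c : ℝ) f,
    φ (w ++ Sum.inr (c • f) :: w') = c • φ (w ++ Sum.inr f :: w')
  swap_section_section : ∀ w w' u v,
    φ (w ++ Sum.inl u :: Sum.inl v :: w') + φ (w ++ Sum.inl v :: Sum.inl u :: w') =
      φ (w ++ Sum.inr (B u v) :: w')
  swap_section_function : ∀ w w' u f,
    φ (w ++ Sum.inl u :: Sum.inr f :: w') = φ (w ++ Sum.inr f :: Sum.inl u :: w')
  swap_function_function : ∀ w w' f g,
    φ (w ++ Sum.inr f :: Sum.inr g :: w') = φ (w ++ Sum.inr g :: Sum.inr f :: w')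
  section_last : ∀ w f u, φ (w ++ [Sum.inl (f • u)]) = f * φ (w ++ [Sum.inl u])
  function_last : ∀ w f g,
    φ (w ++ [Sum.inr (f * g)]) = f * φ (w ++ [Sum.inr g]) + g * φ (w ++ [Sum.inr f])

/-- The element `{φ, a}`, where `a` is a section or a function. -/
def contract (φ : Word R E → R) (a : E ⊕ R) : Word R E → R := fun w => φ (a :: w)

/-- The parity automorphism, multiplication by `(-1)ⁿ` in degree `n`. -/
def parity (φ : Word R E → R) : Word R E → R := fun w => (-1) ^ weight w * φ w

open Classical in
/-- The section given by the component of degree `1` of `φ`: the section `u` such that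
`B u v = {φ, v}` for all sections `v`. -/
def sectionPart (B : LinearMap.BilinForm R E) (φ : Word R E → R) : E :=
  if h : ∃ u : E, ∀ v, B u v = φ [Sum.inl v] then h.choose else 0

/-- The value of `{φ, ψ}` on a word.  On the empty word it is the component of degree `0` of
`{φ, ψ}`, coming from the components of degrees `(2, 0)`, `(0, 2)` and `(1, 1)` of `(φ, ψ)`.
Longer words are treated with the graded Jacobi identity
`{{φ, ψ}, a} = {φ, {ψ, a}} + (-1) ^ (|ψ| |a|) {{φ, a}, ψ}`. -/
def poissonAt (B : LinearMap.BilinForm R E) :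
    Word R E → (Word R E → R) → (Word R E → R) → R
  | [], φ, ψ =>
      φ [Sum.inr (ψ [])] - ψ [Sum.inr (φ [])] + B (sectionPart B φ) (sectionPart B ψ)
  | Sum.inl u :: w, φ, ψ =>
      poissonAt B w φ (contract ψ (Sum.inl u)) + poissonAt B w (contract φ (Sum.inl u)) (parity ψ)
  | Sum.inr f :: w, φ, ψ =>
      poissonAt B w φ (contract ψ (Sum.inr f)) + poissonAt B w (contract φ (Sum.inr f)) ψ

/-- The Poisson bracket `{φ, ψ}`, of degree `-2`. -/
def poisson (B : LinearMap.BilinForm R E) (φ ψ : Word R E → R) : Word R E → R :=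
  fun w => poissonAt B w φ ψ

/-- `Θ` is a Courant algebroid structure on `(E, B)`: it is of degree `3` and `{Θ, Θ} = 0`. -/
def IsCourantStructure (B : LinearMap.BilinForm R E) (Θ : Word R E → R) : Prop :=
  IsOfDegree B 3 Θ ∧ poisson B Θ Θ = 0

/-- The function of degree `2` associated with a skew-symmetric endomorphism `N` of `E`; it is
characterized by `{u, Ñ} = N u`, that is, by `{{Ñ, u}, v} = - B (N u) v`, and `{Ñ, f} = 0`. -/
def endoFn (B : LinearMap.BilinForm R E) (N : E → E) : Word R E → R
  | [Sum.inl u, Sum.inl v] => -B (N u) v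
  | _ => 0

/-- The function `μ` of degree `3` on the minimal symplectic realization of `L ⊕ L*` given by a
bracket `br` on `L` and an anchor `ρ`.  Here `p` is the pairing of `L*` and `L`, and `a`, `b` are
the two components of a section of `L ⊕ L*`.  With the Lie derivative
`(L_X η)(Z) = ρ(X) η(Z) - η([X, Z])` and the differential
`dξ(Y, Z) = ρ(Y) ξ(Z) - ρ(Z) ξ(Y) - ξ([Y, Z])`, it is characterized by
`{{X + ξ, μ}, Y + η} = [X, Y] + L_X η - i_Y dξ` and `{{X + ξ, μ}, f} = ρ(X) f`. -/
def algebroidFn {L L' : Type*} (br : L → L → L) (ρ : L → R → R) (p : L' → L → R)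
    (a : E → L) (b : E → L') : Word R E → R
  | [Sum.inl u, Sum.inl v, Sum.inl w] =>
      p (b w) (br (a u) (a v)) + (ρ (a u) (p (b v) (a w)) - p (b v) (br (a u) (a w))) -
        (ρ (a v) (p (b u) (a w)) - ρ (a w) (p (b u) (a v)) - p (b u) (br (a v) (a w)))
  | [Sum.inl u, Sum.inr f] => ρ (a u) f
  | [Sum.inr f, Sum.inl u] => ρ (a u) f
  | _ => 0

end Algebra

/-! ## Vector bundles -/

section Geometry

variable {EM : Type*} [NormedAddCommGroup EM] [NormedSpace ℝ EM]
  {H : Type*} [TopologicalSpace H] (I : ModelWithCorners ℝ EM H)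
  {M : Type*} [TopologicalSpace M] [ChartedSpace H M]

section Sections

variable (F : Type*) [NormedAddCommGroup F] [NormedSpace ℝ F]
  (V : M → Type*) [TopologicalSpace (TotalSpace F V)]
  [∀ x, AddCommGroup (V x)] [∀ x, Module ℝ (V x)] [∀ x, TopologicalSpace (V x)]
  [FiberBundle F V] [VectorBundle ℝ F V]

variable {I F V} in
/-- Smooth sections form a module over the smooth functions. -/
instance sectionModule : Module C^∞⟮I, M; ℝ⟯ Cₛ^∞⟮I; F, V⟯ where
  smul f s := ⟨fun x => f x • s x, f.contMDiff.smul_section s.contMDiff⟩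
  one_smul s := by ext x; exact one_smul ℝ (s x)
  mul_smul f g s := by ext x; exact mul_smul (f x) (g x) (s x)
  smul_zero f := by ext x; exact smul_zero (f x)
  smul_add f s t := by ext x; exact smul_add (f x) (s x) (t x)
  add_smul f g s := by ext x; exact add_smul (f x) (g x) (s x)
  zero_smul s := by ext x; exact zero_smul ℝ (s x)

/-- The dual bundle `V*`. -/
abbrev DualBundle : M → Type _ := fun x => V x →L[ℝ] Bundle.Trivial M ℝ x

/-- Smooth sections of the dual bundle. -/
abbrev DualSection := Cₛ^∞⟮I; F →L[ℝ] ℝ, DualBundle V⟯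

end Sections

section HomSections

variable {F₁ : Type*} [NormedAddCommGroup F₁] [NormedSpace ℝ F₁]
  {V₁ : M → Type*} [TopologicalSpace (TotalSpace F₁ V₁)]
  [∀ x, AddCommGroup (V₁ x)] [∀ x, Module ℝ (V₁ x)] [∀ x, TopologicalSpace (V₁ x)]
  [FiberBundle F₁ V₁] [VectorBundle ℝ F₁ V₁]
  {F₂ : Type*} [NormedAddCommGroup F₂] [NormedSpace ℝ F₂]
  {V₂ : M → Type*} [TopologicalSpace (TotalSpace F₂ V₂)]
  [∀ x, AddCommGroup (V₂ x)] [∀ x, Module ℝ (V₂ x)] [∀ x, TopologicalSpace (V₂ x)]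
  [∀ x, IsTopologicalAddGroup (V₂ x)] [∀ x, ContinuousSMul ℝ (V₂ x)]
  [FiberBundle F₂ V₂] [VectorBundle ℝ F₂ V₂]
  {F₃ : Type*} [NormedAddCommGroup F₃] [NormedSpace ℝ F₃]
  {V₃ : M → Type*} [TopologicalSpace (TotalSpace F₃ V₃)]
  [∀ x, AddCommGroup (V₃ x)] [∀ x, Module ℝ (V₃ x)] [∀ x, TopologicalSpace (V₃ x)]
  [∀ x, IsTopologicalAddGroup (V₃ x)] [∀ x, ContinuousSMul ℝ (V₃ x)]
  [FiberBundle F₃ V₃] [VectorBundle ℝ F₃ V₃]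

variable (F₁ V₁ F₂ V₂) in
/-- Smooth vector bundle morphisms `V₁ → V₂` over the identity of `M`. -/
abbrev BundleHom := Cₛ^∞⟮I; F₁ →L[ℝ] F₂, fun x => V₁ x →L[ℝ] V₂ x⟯

variable {I}

/-- The map on smooth sections induced by a vector bundle morphism. -/
def BundleHom.onSections (N : BundleHom I F₁ V₁ F₂ V₂) (s : Cₛ^∞⟮I; F₁, V₁⟯) :
    Cₛ^∞⟮I; F₂, V₂⟯ :=
  ⟨fun x => N x (s x), N.contMDiff.clm_bundle_apply s.contMDiff⟩

/-- Composition of vector bundle morphisms. -/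
def BundleHom.comp (K : BundleHom I F₂ V₂ F₃ V₃) (N : BundleHom I F₁ V₁ F₂ V₂) :
    BundleHom I F₁ V₁ F₃ V₃ :=
  ⟨fun x => (K x).comp (N x), by
    intro x
    have hK := (contMDiffAt_hom_bundle _).1 (K.contMDiff x)
    have hN := (contMDiffAt_hom_bundle _).1 (N.contMDiff x)
    refine (contMDiffAt_hom_bundle _).2 ⟨contMDiffAt_id, ?_⟩
    refine (hK.2.clm_comp hN.2).congr_of_eventuallyEq ?_
    filter_upwards [(trivializationAt F₂ V₂ x).open_baseSet.mem_nhds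
      (FiberBundle.mem_baseSet_trivializationAt F₂ V₂ x)] with y hy
    ext v
    simp [ContinuousLinearMap.inCoordinates, hy]⟩

/-- The transpose `V₂* → V₁*` of a vector bundle morphism `V₁ → V₂`. -/
def BundleHom.transpose (N : BundleHom I F₁ V₁ F₂ V₂) :
    BundleHom I (F₂ →L[ℝ] ℝ) (DualBundle V₂) (F₁ →L[ℝ] ℝ) (DualBundle V₁) :=
  ⟨fun x => ContinuousLinearMap.precomp (Bundle.Trivial M ℝ x) (N x), by
    intro x
    have hN := (contMDiffAt_hom_bundle _).1 (N.contMDiff x)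
    refine (contMDiffAt_hom_bundle _).2 ⟨contMDiffAt_id, ?_⟩
    refine (hN.2.clm_precomp (F₃ := ℝ)).congr_of_eventuallyEq ?_
    filter_upwards [(trivializationAt F₂ V₂ x).open_baseSet.mem_nhds
      (FiberBundle.mem_baseSet_trivializationAt F₂ V₂ x),
      (trivializationAt F₁ V₁ x).open_baseSet.mem_nhds
      (FiberBundle.mem_baseSet_trivializationAt F₁ V₁ x)] with y hy hy'
    ext v w
    have hd : y ∈ (trivializationAt (F₂ →L[ℝ] ℝ) (DualBundle V₂) x).baseSet := by
      simp [hom_trivializationAt_baseSet, hy]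
    have hd' : y ∈ (trivializationAt (F₁ →L[ℝ] ℝ) (DualBundle V₁) x).baseSet := by
      simp [hom_trivializationAt_baseSet, hy']
    have hv := congrArg Prod.snd
      ((trivializationAt (F₂ →L[ℝ] ℝ) (DualBundle V₂) x).apply_mk_symm hd v)
    simp only [hom_trivializationAt_apply] at hv
    have hw := DFunLike.congr_fun hv
      (trivializationAt F₂ V₂ x ⟨y, N y ((trivializationAt F₁ V₁ x).symm y w)⟩).2
    simp [ContinuousLinearMap.inCoordinates, hy] at hw
    simp [ContinuousLinearMap.inCoordinates, hy, hy', hom_trivializationAt_apply, hw]⟩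

/-- The morphism `-N`. -/
def BundleHom.neg (N : BundleHom I F₁ V₁ F₂ V₂) : BundleHom I F₁ V₁ F₂ V₂ := -N

/-- The morphism `-ᵗN : V₂* → V₁*`. -/
def BundleHom.negTranspose (N : BundleHom I F₁ V₁ F₂ V₂) :
    BundleHom I (F₂ →L[ℝ] ℝ) (DualBundle V₂) (F₁ →L[ℝ] ℝ) (DualBundle V₁) :=
  N.transpose.neg

end HomSections

section Algebroids

variable {F : Type*} [NormedAddCommGroup F] [NormedSpace ℝ F]
  {V : M → Type*} [TopologicalSpace (TotalSpace F V)]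
  [∀ x, AddCommGroup (V x)] [∀ x, Module ℝ (V x)] [∀ x, TopologicalSpace (V x)]
  [FiberBundle F V] [VectorBundle ℝ F V]

variable {I}

/-- The duality pairing of a section of `V*` and a section of `V`. -/
def pairing (ξ : DualSection I F V) (X : Cₛ^∞⟮I; F, V⟯) : C^∞⟮I, M; ℝ⟯ :=
  ⟨fun x => ξ x (X x), fun x =>
    (contMDiffAt_totalSpace.1 ((ξ.contMDiff.clm_bundle_apply X.contMDiff) x)).2⟩

variable [IsManifold I ∞ M]

variable (I F V) in
/-- An anchor `V → TM` and a bracket on the smooth sections of `V`. -/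
structure AnchoredBracket where
  anchor : BundleHom I F V EM (fun x : M => TangentSpace I x)
  bracket : Cₛ^∞⟮I; F, V⟯ → Cₛ^∞⟮I; F, V⟯ → Cₛ^∞⟮I; F, V⟯

/-- The derivative `ρ(X) · f` of a function along the image of a section under the anchor. -/
def AnchoredBracket.deriv (D : AnchoredBracket I F V) (X : Cₛ^∞⟮I; F, V⟯) (f : C^∞⟮I, M; ℝ⟯) :
    C^∞⟮I, M; ℝ⟯ :=
  ⟨fun x => mvfderiv I f x (D.anchor x (X x)),
    (contMDiff_snd_tangentBundle_modelSpace ℝ 𝓘(ℝ, ℝ)).comp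
      ((f.contMDiff.contMDiff_tangentMap (m := ∞) (by simp)).comp
        (D.anchor.onSections X).contMDiff)⟩

/-- `D` is a Lie algebroid structure on `V`. -/
structure IsLieAlgebroid (D : AnchoredBracket I F V) : Prop where
  add_left : ∀ X Y Z, D.bracket (X + Y) Z = D.bracket X Z + D.bracket Y Z
  smul_left : ∀ (c : ℝ) X Y, D.bracket (c • X) Y = c • D.bracket X Y
  skew : ∀ X Y, D.bracket X Y = -D.bracket Y X
  jacobi : ∀ X Y Z,
    D.bracket X (D.bracket Y Z) = D.bracket (D.bracket X Y) Z + D.bracket Y (D.bracket X Z)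
  leibniz : ∀ X (f : C^∞⟮I, M; ℝ⟯) Y, D.bracket X (f • Y) = f • D.bracket X Y + D.deriv X f • Y
  anchor_bracket : ∀ X Y f,
    D.deriv (D.bracket X Y) f = D.deriv X (D.deriv Y f) - D.deriv Y (D.deriv X f)

section Nijenhuis

variable [∀ x, IsTopologicalAddGroup (V x)] [∀ x, ContinuousSMul ℝ (V x)]

/-- The bracket `[X, Y]_N = [N X, Y] + [X, N Y] - N [X, Y]` with the anchor `ρ ∘ N`. -/
def AnchoredBracket.deform (D : AnchoredBracket I F V) (N : BundleHom I F V F V) :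
    AnchoredBracket I F V where
  anchor := D.anchor.comp N
  bracket X Y := D.bracket (N.onSections X) Y + D.bracket X (N.onSections Y) -
    N.onSections (D.bracket X Y)

/-- The Nijenhuis torsion `[N X, N Y] - N [X, Y]_N`. -/
def torsion (D : AnchoredBracket I F V) (N : BundleHom I F V F V) (X Y : Cₛ^∞⟮I; F, V⟯) :
    Cₛ^∞⟮I; F, V⟯ :=
  D.bracket (N.onSections X) (N.onSections Y) - N.onSections ((D.deform N).bracket X Y)

/-- `N` is a cps (complex, paracomplex or subtangent) structure: `N² = ε Id` with
`ε = -1`, `1` or `0`, and the torsion of `N` vanishes. -/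
def IsCps (D : AnchoredBracket I F V) (N : BundleHom I F V F V) : Prop :=
  (∃ ε : ℝ, (ε = -1 ∨ ε = 1 ∨ ε = 0) ∧ ∀ x v, N x (N x v) = ε • v) ∧
    ∀ X Y, torsion D N X Y = 0

/-- `N` is a real multiple of a cps structure. -/
def IsProportionalToCps (D : AnchoredBracket I F V) (N : BundleHom I F V F V) : Prop :=
  ∃ (c : ℝ) (N₀ : BundleHom I F V F V), IsCps D N₀ ∧ N = c • N₀

end Nijenhuis

/-! ## Lie bialgebroids and their doubles -/

variable (I F V) in
/-- Smooth sections of `V ⊕ V*`. -/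
abbrev DoubleSection := Cₛ^∞⟮I; F, V⟯ × DualSection I F V

variable (I F V) in
/-- The canonical form `⟨X + ξ, Y + η⟩ = ξ(Y) + η(X)` on `V ⊕ V*`. -/
def canonicalForm : LinearMap.BilinForm C^∞⟮I, M; ℝ⟯ (DoubleSection I F V) :=
  LinearMap.mk₂ _ (fun u v => pairing u.2 v.1 + pairing v.2 u.1)
    (fun u u' v => by
      ext x
      change (u.2 x + u'.2 x) (v.1 x) + v.2 x (u.1 x + u'.1 x) =
        u.2 x (v.1 x) + v.2 x (u.1 x) + (u'.2 x (v.1 x) + v.2 x (u'.1 x))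
      rw [add_apply, map_add]
      exact add_add_add_comm _ _ _ _)
    (fun f u v => by
      ext x
      change (f x • u.2 x) (v.1 x) + v.2 x (f x • u.1 x) =
        f x • (u.2 x (v.1 x) + v.2 x (u.1 x))
      rw [smul_apply, map_smul, smul_add])
    (fun u v v' => by
      ext x
      change u.2 x (v.1 x + v'.1 x) + (v.2 x + v'.2 x) (u.1 x) =
        u.2 x (v.1 x) + v.2 x (u.1 x) + (u.2 x (v'.1 x) + v'.2 x (u.1 x))
      rw [add_apply, map_add]
      exact add_add_add_comm _ _ _ _)
    (fun f u v => by
      ext x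
      change u.2 x (f x • v.1 x) + (f x • v.2 x) (u.1 x) =
        f x • (u.2 x (v.1 x) + v.2 x (u.1 x))
      rw [smul_apply, map_smul, smul_add])

variable (I F V) in
/-- Functions on `T*[2]V[1]`, the minimal symplectic realization of `V ⊕ V*`, as functions on
words. -/
abbrev BigFunction :=
  Word C^∞⟮I, M; ℝ⟯ (DoubleSection I F V) → C^∞⟮I, M; ℝ⟯

/-- The function on `T*[2]V[1]` of an anchored bracket on `V`. -/
def muFn (D : AnchoredBracket I F V) : BigFunction I F V :=
  algebroidFn D.bracket D.deriv pairing Prod.fst Prod.snd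

/-- The function on `T*[2]V[1]` of an anchored bracket on `V*`. -/
def gammaFn (D' : AnchoredBracket I (F →L[ℝ] ℝ) (DualBundle V)) : BigFunction I F V :=
  algebroidFn D'.bracket D'.deriv (fun X ξ => pairing ξ X) Prod.snd Prod.fst

/-- A Lie bialgebroid: Lie algebroid structures `μ` on `V` and `γ` on `V*` with `{μ, γ} = 0`. -/
structure IsLieBialgebroid (D : AnchoredBracket I F V)
    (D' : AnchoredBracket I (F →L[ℝ] ℝ) (DualBundle V)) : Prop where
  left : IsLieAlgebroid D
  right : IsLieAlgebroid D'
  compatible : poisson (canonicalForm I F V) (muFn D) (gammaFn D') = 0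

/-- The double `μ + γ` of a pair of anchored brackets on `V` and `V*`. -/
def double (D : AnchoredBracket I F V)
    (D' : AnchoredBracket I (F →L[ℝ] ℝ) (DualBundle V)) : BigFunction I F V :=
  muFn D + gammaFn D'

/-- The function of degree `2` of the skew-symmetric endomorphism `X + ξ ↦ N X - ᵗN ξ` of
`V ⊕ V*`. -/
def tildeFn [∀ x, IsTopologicalAddGroup (V x)] [∀ x, ContinuousSMul ℝ (V x)]
    (N : BundleHom I F V F V) : BigFunction I F V :=
  endoFn (canonicalForm I F V) fun u => (N.onSections u.1, N.negTranspose.onSections u.2)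

end Algebroids

end Geometry

end LieBialgebroid

end

open LieBialgebroid

set_option linter.unusedSectionVars false

namespace LieBialgebroid

/-! ### Calculus of the graded Poisson bracket on words. -/

section PoissonAlgebra

variable {R E : Type*} [CommRing R] [Algebra ℝ R] [AddCommGroup E] [Module R E]

/-! Write `D` for the bracket with the degree-two element of the skew endomorphism `N ⊕ -ᵗN`.
Skew-symmetry makes `D` a derivation of the Poisson bracket (`derivation_poisson`), and `D` deforms
both structures: `D μ = μ_N` and `D γ = γ_{-ᵗN}` (`derivation_algebroidFn`). Vanishing torsion makes
the two deformed structures Lie algebroids (`IsLieRinehart.deform`).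

Compatibility of the deformed structures comes from a second application of `D`. If `N` has no
torsion and `N² = c`, then deforming twice multiplies the structure by `c`, so `D² μ = c μ`. Since
`(-ᵗN)² = ᵗ(N²) = c`, also `D² γ = c γ`, with the same constant (`negTranspose_sq`). Expanding `D²
{μ, γ} = 0` by the Leibniz rule gives `2 c {μ, γ} + 2 {D μ, D γ} = 0`. As `{μ, γ} = 0`, it follows
that `{D μ, D γ} = 0` (`poisson_derivation_eq_zero`).

A Lie algebroid structure satisfies the master equation because its bracket on `A ⊕ A*` obeys the
Courant axioms (`IsOfDegree.poisson_self_eq_zero`). Two commuting solutions of degree three add up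
to a solution, which yields the double.

The Poisson bracket is defined by recursion on words and by a choice of representing section. Its
expected properties therefore have to be proved, by induction on words. The inductions rest on
representability of functionals on sections, which geometrically is the perfect duality of the
modules of sections of `A` and `A*` (`isPerfPair_pairingMap`). -/

/-- The sections are represented by the form, and the last letter enters `ℝ`-linearly. -/
structure IsRegular (B : LinearMap.BilinForm R E) (φ : Word R E → R) : Prop where
  representable : ∀ w, ∃ u : E, ∀ v, B u v = φ (w ++ [Sum.inl v])
  map_add : ∀ w f g, φ (w ++ [Sum.inr (f + g)]) = φ (w ++ [Sum.inr f]) + φ (w ++ [Sum.inr g])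
  map_smul : ∀ w (c : ℝ) f, φ (w ++ [Sum.inr (c • f)]) = c • φ (w ++ [Sum.inr f])

/-- A regular function on words obeying the graded Jacobi identity. -/
structure IsPoissonFn (B : LinearMap.BilinForm R E) (φ : Word R E → R) : Prop
    extends IsRegular B φ where
  add_section : ∀ w w' u v,
    φ (w ++ Sum.inl (u + v) :: w') = φ (w ++ Sum.inl u :: w') + φ (w ++ Sum.inl v :: w')
  swap_section_section : ∀ w w' u v,
    φ (w ++ Sum.inl u :: Sum.inl v :: w') + φ (w ++ Sum.inl v :: Sum.inl u :: w') =
      φ (w ++ Sum.inr (B u v) :: w')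
  swap_section_function : ∀ w w' u f,
    φ (w ++ Sum.inl u :: Sum.inr f :: w') = φ (w ++ Sum.inr f :: Sum.inl u :: w')
  swap_function_function : ∀ w w' f g,
    φ (w ++ Sum.inr f :: Sum.inr g :: w') = φ (w ++ Sum.inr g :: Sum.inr f :: w')

/-- The function of degree `1` of a section. -/
def sectionFn (B : LinearMap.BilinForm R E) (s : E) : Word R E → R
  | [Sum.inl v] => B s v
  | _ => 0

/-- The function of degree `0` of an element of `R`. -/
def constFn (g : R) : Word R E → R
  | [] => g
  | _ => 0

variable {B : LinearMap.BilinForm R E} {φ φ' ψ ψ' : Word R E → R}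

@[simp] lemma contract_apply (φ : Word R E → R) (a : E ⊕ R) (w : Word R E) :
    contract φ a w = φ (a :: w) := rfl

@[simp] lemma contract_add (φ ψ : Word R E → R) (a : E ⊕ R) :
    contract (φ + ψ) a = contract φ a + contract ψ a := rfl

@[simp] lemma contract_smul (c : ℝ) (φ : Word R E → R) (a : E ⊕ R) :
    contract (c • φ) a = c • contract φ a := rfl

@[simp] lemma parity_add (φ ψ : Word R E → R) : parity (φ + ψ) = parity φ + parity ψ := by
  funext w; simp [parity, mul_add]

@[simp] lemma parity_smul (c : ℝ) (φ : Word R E → R) : parity (c • φ) = c • parity φ := by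
  funext w; simp [parity]

@[simp] lemma parity_parity (φ : Word R E → R) : parity (parity φ) = φ := by
  funext w; simp [parity, ← mul_assoc, ← mul_pow]

/-- A section is odd, so removing it from a word changes the sign of the parity automorphism; a
function is even and changes nothing. -/
lemma contract_parity_section (φ : Word R E → R) (u : E) :
    contract (parity φ) (Sum.inl u) = (-1 : ℝ) • parity (contract φ (Sum.inl u)) := by
  funext w; simp [parity, contract, weight, pow_succ]

lemma contract_parity_function (φ : Word R E → R) (f : R) :
    contract (parity φ) (Sum.inr f) = parity (contract φ (Sum.inr f)) := by
  funext w; simp [parity, contract, weight, pow_succ]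

@[simp] lemma contract_sectionFn_section (s v : E) :
    contract (sectionFn B s) (Sum.inl v) = constFn (B s v) := by
  funext w; cases w <;> rfl

@[simp] lemma contract_sectionFn_function (s : E) (f : R) :
    contract (sectionFn B s) (Sum.inr f) = 0 := by
  funext w; cases w <;> rfl

@[simp] lemma contract_constFn (g : R) (a : E ⊕ R) :
    contract (constFn g : Word R E → R) a = 0 := by
  funext w; cases w <;> rfl

lemma parity_sectionFn (s : E) : parity (sectionFn B s) = (-1 : ℝ) • sectionFn B s := by
  funext w
  match w with
  | [] => simp [parity, sectionFn]
  | [Sum.inl v] => simp [parity, sectionFn, weight]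
  | [Sum.inr f] => simp [parity, sectionFn]
  | _ :: _ :: _ => simp [parity, sectionFn]

@[simp] lemma contract_endoFn_section (T : E → E) (u : E) :
    contract (endoFn B T) (Sum.inl u) = sectionFn B (-T u) := by
  funext w
  match w with
  | [] => rfl
  | [Sum.inl v] => simp [endoFn, sectionFn]
  | [Sum.inr f] => rfl
  | _ :: _ :: _ => simp [endoFn, sectionFn]

@[simp] lemma contract_endoFn_function (T : E → E) (f : R) :
    contract (endoFn B T) (Sum.inr f) = 0 := by
  funext w; cases w <;> rfl

lemma weight_append (w w' : Word R E) : weight (w ++ w') = weight w + weight w' := by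
  induction w with
  | nil => simp [weight]
  | cons a w ih => rcases a with a | a <;> simp [weight, ih, add_right_comm]

lemma weight_eq_zero {w : Word R E} (h : weight w = 0) : w = [] := by
  rcases w with _ | ⟨u | f, w⟩ <;> simp [weight] at h ⊢

lemma weight_eq_one {w : Word R E} (h : weight w = 1) : ∃ u, w = [Sum.inl u] := by
  rcases w with _ | ⟨u | f, w⟩ <;> simp [weight] at h ⊢
  exact weight_eq_zero h

lemma weight_eq_two {w : Word R E} (h : weight w = 2) :
    (∃ u v, w = [Sum.inl u, Sum.inl v]) ∨ ∃ f, w = [Sum.inr f] := by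
  rcases w with _ | ⟨u | f, w⟩ <;> simp [weight] at h ⊢
  · exact weight_eq_one h
  · exact weight_eq_zero h

/-- These are the only words on which an element of degree three can be non-zero, so identities in
degree three become three computations. -/
lemma weight_eq_three {w : Word R E} (h : weight w = 3) :
    (∃ u v x, w = [Sum.inl u, Sum.inl v, Sum.inl x]) ∨ (∃ u f, w = [Sum.inl u, Sum.inr f]) ∨
      ∃ f u, w = [Sum.inr f, Sum.inl u] := by
  rcases w with _ | ⟨u | f, w⟩ <;> simp [weight] at h ⊢
  · exact weight_eq_two h
  · exact weight_eq_one h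

namespace IsRegular

lemma contract (h : IsRegular B φ) (a : E ⊕ R) : IsRegular B (contract φ a) where
  representable w := h.representable (a :: w)
  map_add w := h.map_add (a :: w)
  map_smul w := h.map_smul (a :: w)

lemma add (h : IsRegular B φ) (h' : IsRegular B φ') : IsRegular B (φ + φ') where
  representable w := by
    obtain ⟨u, hu⟩ := h.representable w
    obtain ⟨u', hu'⟩ := h'.representable w
    exact ⟨u + u', fun v => by simp [hu, hu']⟩
  map_add w f g := by simp only [Pi.add_apply, h.map_add, h'.map_add]; ring
  map_smul w c f := by simp only [Pi.add_apply, h.map_smul, h'.map_smul, smul_add]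

lemma zero : IsRegular B (0 : Word R E → R) where
  representable w := ⟨0, by simp⟩
  map_add := by simp
  map_smul := by simp

lemma parity (h : IsRegular B φ) : IsRegular B (parity φ) where
  representable w := by
    obtain ⟨u, hu⟩ := h.representable w
    -- The appended section letter contributes the extra one in the exponent.
    refine ⟨((-1 : R) ^ (weight w + 1)) • u, fun v => ?_⟩
    simp [hu, LieBialgebroid.parity, weight_append, weight]
  map_add w f g := by
    simp only [LieBialgebroid.parity, weight_append, weight, h.map_add, mul_add]
  map_smul w c f := by
    simp only [LieBialgebroid.parity, weight_append, weight, h.map_smul, mul_smul_comm]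

lemma sectionFn (s : E) : IsRegular B (sectionFn B s) where
  representable w := by
    cases w with
    | nil => exact ⟨s, fun v => rfl⟩
    | cons a w => exact ⟨0, fun v => by cases w <;> simp [LieBialgebroid.sectionFn]⟩
  map_add w f g := by
    rcases w with _ | ⟨a, _ | ⟨b, w⟩⟩ <;> simp [LieBialgebroid.sectionFn]
  map_smul w c f := by
    rcases w with _ | ⟨a, _ | ⟨b, w⟩⟩ <;> simp [LieBialgebroid.sectionFn]

lemma apply_zero (h : IsRegular B φ) : φ [Sum.inr 0] = 0 := by
  simpa using h.map_smul [] 0 0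

end IsRegular

/-- Non-degeneracy makes the chosen section unique, which turns the choice into a computation rule.
-/
lemma sectionPart_eq (hB : B.SeparatingLeft) {u : E} (h : ∀ v, B u v = φ [Sum.inl v]) :
    sectionPart B φ = u := by
  have hex : ∃ u : E, ∀ v, B u v = φ [Sum.inl v] := ⟨u, h⟩
  rw [sectionPart, dif_pos hex, ← sub_eq_zero]
  refine hB _ fun v => ?_
  rw [map_sub, LinearMap.sub_apply, hex.choose_spec, h, sub_self]

lemma IsRegular.sectionPart_spec (h : IsRegular B φ) (v : E) :
    B (sectionPart B φ) v = φ [Sum.inl v] := by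
  have hex : ∃ u : E, ∀ v, B u v = φ [Sum.inl v] := h.representable []
  rw [sectionPart, dif_pos hex, hex.choose_spec]

lemma sectionPart_eq_zero (hB : B.SeparatingLeft) (h : ∀ v, φ [Sum.inl v] = 0) :
    sectionPart B φ = 0 :=
  sectionPart_eq hB fun v => by simp [h]

lemma sectionPart_add (hB : B.SeparatingLeft) (h : IsRegular B φ) (h' : IsRegular B φ') :
    sectionPart B (φ + φ') = sectionPart B φ + sectionPart B φ' :=
  sectionPart_eq hB fun v => by simp [h.sectionPart_spec, h'.sectionPart_spec]

lemma sectionPart_smul (hB : B.SeparatingLeft) (h : IsRegular B φ) (c : ℝ) :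
    sectionPart B (c • φ) = algebraMap ℝ R c • sectionPart B φ :=
  sectionPart_eq hB fun v => by simp [h.sectionPart_spec, Algebra.smul_def]

/-- On the empty word additivity uses both halves of regularity: representability makes
`sectionPart` additive, and a function letter in last position enters additively. Contraction and
parity preserve regularity, so the induction goes through. -/
lemma poissonAt_add_left (hB : B.SeparatingLeft) (w : Word R E) (hφ : IsRegular B φ)
    (hφ' : IsRegular B φ') (hψ : IsRegular B ψ) :
    poissonAt B w (φ + φ') ψ = poissonAt B w φ ψ + poissonAt B w φ' ψ := by
  induction w generalizing φ φ' ψ with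
  | nil =>
    have := hψ.map_add [] (φ []) (φ' [])
    simp only [List.nil_append] at this
    simp only [poissonAt, Pi.add_apply, sectionPart_add hB hφ hφ', map_add,
      LinearMap.add_apply, this]
    ring
  | cons a w ih =>
    rcases a with u | f
    · simp only [poissonAt, contract_add]
      rw [ih hφ hφ' (hψ.contract _), ih (hφ.contract _) (hφ'.contract _) hψ.parity]
      ring
    · simp only [poissonAt, contract_add]
      rw [ih hφ hφ' (hψ.contract _), ih (hφ.contract _) (hφ'.contract _) hψ]
      ring

lemma poissonAt_add_right (hB : B.SeparatingLeft) (w : Word R E) (hφ : IsRegular B φ)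
    (hψ : IsRegular B ψ) (hψ' : IsRegular B ψ') :
    poissonAt B w φ (ψ + ψ') = poissonAt B w φ ψ + poissonAt B w φ ψ' := by
  induction w generalizing φ ψ ψ' with
  | nil =>
    have := hφ.map_add [] (ψ []) (ψ' [])
    simp only [List.nil_append] at this
    simp only [poissonAt, Pi.add_apply, sectionPart_add hB hψ hψ', map_add, this]
    ring
  | cons a w ih =>
    rcases a with u | f
    · simp only [poissonAt, contract_add, parity_add]
      rw [ih hφ (hψ.contract _) (hψ'.contract _), ih (hφ.contract _) hψ.parity hψ'.parity]
      ring
    · simp only [poissonAt, contract_add]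
      rw [ih hφ (hψ.contract _) (hψ'.contract _), ih (hφ.contract _) hψ hψ']
      ring

lemma poissonAt_smul_left (hB : B.SeparatingLeft) (w : Word R E) (c : ℝ) (hφ : IsRegular B φ)
    (hψ : IsRegular B ψ) : poissonAt B w (c • φ) ψ = c • poissonAt B w φ ψ := by
  induction w generalizing φ ψ with
  | nil =>
    have := hψ.map_smul [] c (φ [])
    simp only [List.nil_append] at this
    simp only [poissonAt, Pi.smul_apply, sectionPart_smul hB hφ, map_smul,
      LinearMap.smul_apply, this]
    simp [Algebra.smul_def, mul_sub, mul_add]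
  | cons a w ih =>
    rcases a with u | f
    · simp only [poissonAt, contract_smul]
      rw [ih hφ (hψ.contract _), ih (hφ.contract _) hψ.parity, smul_add]
    · simp only [poissonAt, contract_smul]
      rw [ih hφ (hψ.contract _), ih (hφ.contract _) hψ, smul_add]

lemma poissonAt_smul_right (hB : B.SeparatingLeft) (w : Word R E) (c : ℝ) (hφ : IsRegular B φ)
    (hψ : IsRegular B ψ) : poissonAt B w φ (c • ψ) = c • poissonAt B w φ ψ := by
  induction w generalizing φ ψ with
  | nil =>
    have := hφ.map_smul [] c (ψ [])
    simp only [List.nil_append] at this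
    simp only [poissonAt, Pi.smul_apply, sectionPart_smul hB hψ, map_smul, this]
    simp [Algebra.smul_def, mul_sub, mul_add]
  | cons a w ih =>
    rcases a with u | f
    · simp only [poissonAt, contract_smul, parity_smul]
      rw [ih hφ (hψ.contract _), ih (hφ.contract _) hψ.parity, smul_add]
    · simp only [poissonAt, contract_smul]
      rw [ih hφ (hψ.contract _), ih (hφ.contract _) hψ, smul_add]

lemma poissonAt_zero_left (hB : B.SeparatingLeft) (w : Word R E) (hψ : IsRegular B ψ) :
    poissonAt B w 0 ψ = 0 := by
  simpa using poissonAt_smul_left hB w 0 IsRegular.zero hψ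

lemma poissonAt_zero_right (hB : B.SeparatingLeft) (w : Word R E) (hφ : IsRegular B φ) :
    poissonAt B w φ 0 = 0 := by
  simpa using poissonAt_smul_right hB w 0 hφ IsRegular.zero

lemma IsPoissonFn.contract (h : IsPoissonFn B φ) (a : E ⊕ R) : IsPoissonFn B (contract φ a) where
  toIsRegular := h.toIsRegular.contract a
  add_section w := h.add_section (a :: w)
  swap_section_section w := h.swap_section_section (a :: w)
  swap_section_function w := h.swap_section_function (a :: w)
  swap_function_function w := h.swap_function_function (a :: w)

/-- Additivity alone suffices: it forces the value at the zero section to vanish. -/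
lemma IsPoissonFn.neg_section (h : IsPoissonFn B φ) (u : E) (w : Word R E) :
    φ (Sum.inl (-u) :: w) = -φ (Sum.inl u :: w) := by
  have h0 := h.add_section [] w 0 0
  have h1 := h.add_section [] w u (-u)
  simp only [List.nil_append, add_zero, add_neg_cancel] at h0 h1
  linear_combination -h0 - h1

/-! ### Brackets with elements of degree `0` and `1` -/

/-- Functions are even, so the letter `g` moves past every other letter without a sign. -/
lemma poissonAt_constFn_left (hB : B.SeparatingLeft) (hφ : IsPoissonFn B φ) (g : R)
    (w : Word R E) : poissonAt B w (constFn g) φ = -φ (Sum.inr g :: w) := by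
  induction w generalizing φ with
  | nil =>
    have : sectionPart B (constFn g) = 0 := sectionPart_eq_zero hB fun v => rfl
    simp [poissonAt, this, constFn]
  | cons a w ih =>
    rcases a with u | f
    · simp only [poissonAt, contract_constFn, poissonAt_zero_left hB w hφ.parity]
      rw [ih (hφ.contract _), add_zero, contract_apply]
      exact congrArg _ (hφ.swap_section_function [] w u g)
    · simp only [poissonAt, contract_constFn, poissonAt_zero_left hB w hφ.toIsRegular]
      rw [ih (hφ.contract _), add_zero, contract_apply]
      exact congrArg _ (hφ.swap_function_function [] w f g)

lemma poissonAt_constFn_right (hB : B.SeparatingLeft) (hφ : IsPoissonFn B φ) (g : R)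
    (w : Word R E) : poissonAt B w φ (constFn g) = φ (Sum.inr g :: w) := by
  have hp : parity (constFn g : Word R E → R) = constFn g := by
    funext w; cases w <;> simp [parity, constFn, weight]
  induction w generalizing φ with
  | nil =>
    have : sectionPart B (constFn g) = 0 := sectionPart_eq_zero hB fun v => rfl
    simp [poissonAt, this, constFn]
  | cons a w ih =>
    rcases a with u | f
    · simp only [poissonAt, contract_constFn, poissonAt_zero_right hB w hφ.toIsRegular, hp]
      rw [ih (hφ.contract _), zero_add, contract_apply]
      exact hφ.swap_section_function [] w u g
    · simp only [poissonAt, contract_constFn, poissonAt_zero_right hB w hφ.toIsRegular]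
      rw [ih (hφ.contract _), zero_add, contract_apply]
      exact hφ.swap_function_function [] w f g

lemma sectionPart_sectionFn (hB : B.SeparatingLeft) (s : E) :
    sectionPart B (sectionFn B s) = s :=
  sectionPart_eq hB fun _ => rfl

/-- Graded symmetry against a section carries a sign depending on the degree of `φ`. Placing the
parity automorphism on `φ` absorbs it, so `φ` need not be homogeneous. The term `{{s, v}, φ}` is the
one that the swap rule for two sections requires. -/
lemma poissonAt_sectionFn_parity (hB : B.SeparatingLeft) (hs : B.IsSymm) (hφ : IsPoissonFn B φ)
    (s : E) (w : Word R E) :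
    poissonAt B w (sectionFn B s) (parity φ) = -φ (Sum.inl s :: w) := by
  induction w generalizing φ with
  | nil =>
    have h1 := hφ.parity.sectionPart_spec s
    simp only [poissonAt, sectionPart_sectionFn hB, hs.eq s, h1]
    simp [sectionFn, parity, weight, hφ.apply_zero]
  | cons a w ih =>
    rcases a with v | f
    · simp only [poissonAt, contract_sectionFn_section, contract_parity_section, parity_parity]
      rw [poissonAt_smul_right hB w _ (.sectionFn s) (hφ.contract _).parity, ih (hφ.contract _),
        poissonAt_constFn_left hB hφ, contract_apply]
      have := hφ.swap_section_section [] w s v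
      simp only [List.nil_append] at this
      rw [← this]
      module
    · simp only [poissonAt, contract_sectionFn_function, contract_parity_function]
      rw [ih (hφ.contract _), poissonAt_zero_left hB w hφ.parity, contract_apply, add_zero]
      exact congrArg _ (hφ.swap_section_function [] w s f).symm

/-- Consistency of the encoding: the recursive bracket with a section agrees with reading off a
letter. -/
lemma poissonAt_sectionFn_right (hB : B.SeparatingLeft) (hφ : IsPoissonFn B φ)
    (s : E) (w : Word R E) : poissonAt B w φ (sectionFn B s) = φ (Sum.inl s :: w) := by
  induction w generalizing φ with
  | nil =>
    have h0 := hφ.apply_zero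
    have h1 := hφ.sectionPart_spec s
    simp only [poissonAt, sectionPart_sectionFn hB, h1]
    simp [h0, sectionFn]
  | cons a w ih =>
    rcases a with v | f
    · simp only [poissonAt, contract_sectionFn_section, parity_sectionFn]
      rw [poissonAt_smul_right hB w _ (hφ.contract _).toIsRegular (.sectionFn s),
        ih (hφ.contract _), poissonAt_constFn_right hB hφ, contract_apply]
      have := hφ.swap_section_section [] w s v
      simp only [List.nil_append] at this
      rw [← this]
      module
    · simp only [poissonAt, contract_sectionFn_function]
      rw [ih (hφ.contract _), poissonAt_zero_right hB w hφ.toIsRegular, contract_apply, zero_add]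
      exact (hφ.swap_section_function [] w s f).symm

/-! ### The derivation of an endomorphism -/

/-- The value on a word of the derivation extending `u ↦ -T u`, `f ↦ 0`. -/
def derivationAt (T : E → E) : Word R E → (Word R E → R) → R
  | [], _ => 0
  | Sum.inl u :: w, φ => derivationAt T w (contract φ (Sum.inl u)) + φ (Sum.inl (T u) :: w)
  | Sum.inr f :: w, φ => derivationAt T w (contract φ (Sum.inr f))

/-- The derivation of functions on words extending `u ↦ -T u`, `f ↦ 0`. -/
def derivation (T : E → E) (φ : Word R E → R) : Word R E → R := fun w => derivationAt T w φ

lemma derivation_add (T : E → E) (φ ψ : Word R E → R) :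
    derivation T (φ + ψ) = derivation T φ + derivation T ψ := by
  funext w
  change derivationAt T w (φ + ψ) = derivationAt T w φ + derivationAt T w ψ
  induction w generalizing φ ψ with
  | nil => simp [derivationAt]
  | cons a w ih =>
    rcases a with u | f
    · simp only [derivationAt, contract_add, ih, Pi.add_apply]; ring
    · simp only [derivationAt, contract_add, ih]

lemma derivation_smul (T : E → E) (c : ℝ) (φ : Word R E → R) :
    derivation T (c • φ) = c • derivation T φ := by
  funext w
  change derivationAt T w (c • φ) = c • derivationAt T w φ
  induction w generalizing φ with
  | nil => simp [derivationAt]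
  | cons a w ih =>
    rcases a with u | f
    · simp only [derivationAt, contract_smul, ih, Pi.smul_apply, smul_add]
    · simp only [derivationAt, contract_smul, ih]

/-- A derivation preserves the degree. -/
lemma derivation_eq_zero (T : E → E) {φ : Word R E → R} {w : Word R E}
    (h : ∀ w', weight w' = weight w → φ w' = 0) : derivation T φ w = 0 := by
  change derivationAt T w φ = 0
  induction w generalizing φ with
  | nil => rfl
  | cons a w ih =>
    rcases a with u | f
    · rw [derivationAt, ih (φ := contract φ (Sum.inl u))
          fun w' hw' => h (Sum.inl u :: w') (by simp [weight, hw']),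
        h _ (by simp [weight]), add_zero]
    · rw [derivationAt, ih (φ := contract φ (Sum.inr f))
          fun w' hw' => h (Sum.inr f :: w') (by simp [weight, hw'])]

lemma derivation_zero (T : E → E) : derivation T (0 : Word R E → R) = 0 := by
  simpa using derivation_smul T 0 (0 : Word R E → R)

/-- The derivation replaces letters by letters of the same weight. -/
lemma derivation_parity (T : E → E) (φ : Word R E → R) :
    derivation T (parity φ) = parity (derivation T φ) := by
  funext w
  change derivationAt T w (parity φ) = (-1) ^ weight w * derivationAt T w φ
  induction w generalizing φ with
  | nil => simp [derivationAt]
  | cons a w ih =>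
    rcases a with u | f
    · have h : derivationAt T w ((-1 : ℝ) • parity (contract φ (Sum.inl u))) =
          (-1 : ℝ) • derivationAt T w (parity (contract φ (Sum.inl u))) :=
        congrFun (derivation_smul T (-1) (parity (contract φ (Sum.inl u)))) w
      simp only [derivationAt, contract_parity_section, weight, h, ih]
      simp only [parity, weight, pow_succ, neg_smul, one_smul]
      ring
    · simp only [derivationAt, contract_parity_function, ih, weight, pow_succ]
      ring

lemma contract_derivation_section (T : E → E) (φ : Word R E → R) (u : E) :
    contract (derivation T φ) (Sum.inl u) =
      derivation T (contract φ (Sum.inl u)) + contract φ (Sum.inl (T u)) := rfl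

lemma contract_derivation_function (T : E → E) (φ : Word R E → R) (f : R) :
    contract (derivation T φ) (Sum.inr f) = derivation T (contract φ (Sum.inr f)) := rfl

variable {T : E → E}

/-- Skew-symmetry enters on the empty word, where it moves `T` onto the representing section; on
longer words the contributions of the letters are simply added. -/
lemma IsRegular.derivation (hT : ∀ u v, B (T u) v = -B u (T v)) (hφ : IsRegular B φ) :
    IsRegular B (derivation T φ) where
  representable w := by
    induction w generalizing φ with
    | nil =>
      obtain ⟨u, hu⟩ := hφ.representable []
      refine ⟨-T u, fun v => ?_⟩
      simpa [hT, LieBialgebroid.derivation, derivationAt] using hu (T v)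
    | cons a w ih =>
      obtain ⟨u, hu⟩ := ih (hφ.contract a)
      rcases a with a | f
      · obtain ⟨u', hu'⟩ := hφ.representable (Sum.inl (T a) :: w)
        refine ⟨u + u', fun v => ?_⟩
        rw [_root_.map_add, LinearMap.add_apply, hu, hu']
        rfl
      · exact ⟨u, hu⟩
  map_add w f g := by
    induction w generalizing φ with
    | nil => simp [LieBialgebroid.derivation, derivationAt]
    | cons a w ih =>
      have h := ih (hφ.contract a)
      rcases a with a | a
      · have h' := hφ.map_add (Sum.inl (T a) :: w) f g
        change LieBialgebroid.derivation T _ _ + φ _ = LieBialgebroid.derivation T _ _ + φ _ +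
          (LieBialgebroid.derivation T _ _ + φ _)
        exact (congrArg₂ (· + ·) h h').trans (add_add_add_comm _ _ _ _)
      · exact h
  map_smul w c f := by
    induction w generalizing φ with
    | nil => simp [LieBialgebroid.derivation, derivationAt]
    | cons a w ih =>
      have h := ih (hφ.contract a)
      rcases a with a | a
      · have h' := hφ.map_smul (Sum.inl (T a) :: w) c f
        change LieBialgebroid.derivation T _ _ + φ _ = c • (LieBialgebroid.derivation T _ _ + φ _)
        rw [smul_add]
        exact congrArg₂ (· + ·) h h'
      · exact h

lemma sectionPart_derivation (hB : B.SeparatingLeft) (hT : ∀ u v, B (T u) v = -B u (T v))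
    (hφ : IsRegular B φ) : sectionPart B (derivation T φ) = -T (sectionPart B φ) :=
  sectionPart_eq hB fun v => by
    simp [hT, hφ.sectionPart_spec, derivation, derivationAt]

/-- The derivation of a skew-symmetric endomorphism is a derivation of the Poisson bracket. -/
lemma derivation_poisson (hB : B.SeparatingLeft) (hT : ∀ u v, B (T u) v = -B u (T v))
    (hφ : IsRegular B φ) (hψ : IsRegular B ψ) :
    derivation T (poisson B φ ψ) =
      poisson B (derivation T φ) ψ + poisson B φ (derivation T ψ) := by
  funext w
  change derivationAt T w (poisson B φ ψ) =
    poissonAt B w (derivation T φ) ψ + poissonAt B w φ (derivation T ψ)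
  induction w generalizing φ ψ with
  | nil =>
    have h0 := hφ.apply_zero
    have h1 := hψ.apply_zero
    -- Function letters are annihilated, and the two terms of the form cancel because `T` is
    -- infinitesimally orthogonal.
    simp only [poissonAt, sectionPart_derivation hB hT hφ, sectionPart_derivation hB hT hψ]
    simp [derivation, derivationAt, h0, h1, hT]
  | cons a w ih =>
    rcases a with u | f
    · have e : contract (poisson B φ ψ) (Sum.inl u) = poisson B φ (contract ψ (Sum.inl u)) +
        poisson B (contract φ (Sum.inl u)) (parity ψ) := rfl
      have e' := congrFun (derivation_add T (poisson B φ (contract ψ (Sum.inl u)))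
        (poisson B (contract φ (Sum.inl u)) (parity ψ))) w
      simp only [derivation, Pi.add_apply] at e'
      simp only [derivationAt, e, e', ih hφ (hψ.contract _), ih (hφ.contract _) hψ.parity,
        poissonAt, contract_derivation_section, derivation_parity, poisson]
      rw [poissonAt_add_left hB w ((hφ.contract _).derivation hT) (hφ.contract _) hψ.parity,
        poissonAt_add_right hB w hφ ((hψ.contract _).derivation hT) (hψ.contract _)]
      ring
    · have e : contract (poisson B φ ψ) (Sum.inr f) = poisson B φ (contract ψ (Sum.inr f)) +
        poisson B (contract φ (Sum.inr f)) ψ := rfl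
      have e' := congrFun (derivation_add T (poisson B φ (contract ψ (Sum.inr f)))
        (poisson B (contract φ (Sum.inr f)) ψ)) w
      simp only [derivation, Pi.add_apply] at e'
      simp only [derivationAt, e, e', ih hφ (hψ.contract _), ih (hφ.contract _) hψ,
        poissonAt, contract_derivation_function]
      ring

/-- The Hamiltonian derivation of the function of a skew-symmetric endomorphism. -/
lemma poisson_endoFn (hB : B.SeparatingLeft) (hs : B.IsSymm) (hφ : IsPoissonFn B φ) :
    poisson B (endoFn B T) φ = derivation T φ := by
  funext w
  change poissonAt B w (endoFn B T) φ = derivationAt T w φ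
  induction w generalizing φ with
  | nil =>
    have h0 := hφ.apply_zero
    have : sectionPart B (endoFn B T) = 0 := sectionPart_eq_zero hB fun v => rfl
    simp [poissonAt, this, endoFn, derivationAt, h0]
  | cons a w ih =>
    rcases a with u | f
    · simp only [poissonAt, contract_endoFn_section, derivationAt]
      rw [ih (hφ.contract _), poissonAt_sectionFn_parity hB hs hφ, hφ.neg_section, neg_neg]
    · simp only [poissonAt, contract_endoFn_function, derivationAt]
      rw [ih (hφ.contract _), poissonAt_zero_left hB w hφ.toIsRegular, add_zero]

/-! ### Graded symmetry -/

/-- The hypothesis is homogeneity modulo two, which is all that graded symmetry needs. The exponent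
`p + 1` stands for the degree `p - 1` and avoids subtraction. -/
lemma parity_contract_section {p : ℕ} (h : parity φ = (-1 : ℝ) ^ p • φ) (u : E) :
    parity (contract φ (Sum.inl u)) = (-1 : ℝ) ^ (p + 1) • contract φ (Sum.inl u) := by
  have := contract_parity_section φ u
  rw [h] at this
  have h' := congrArg ((-1 : ℝ) • ·) this
  simp only [smul_smul, contract_smul] at h'
  simpa [pow_succ'] using h'.symm

lemma parity_contract_function {p : ℕ} (h : parity φ = (-1 : ℝ) ^ p • φ) (f : R) :
    parity (contract φ (Sum.inr f)) = (-1 : ℝ) ^ p • contract φ (Sum.inr f) := by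
  rw [← contract_parity_function, h, contract_smul]

/-- The two signs disagree, so `φ w = -φ w`, and two is invertible in an `ℝ`-algebra. -/
lemma eq_zero_of_parity {p : ℕ} (h : parity φ = (-1 : ℝ) ^ p • φ) {w : Word R E}
    (hw : Odd (weight w + p)) : φ w = 0 := by
  have := congrFun h w
  have hx : φ w = -φ w := by
    rcases Nat.even_or_odd p with hp | hp
    · have := congrFun h w
      rw [Nat.odd_add] at hw
      simpa [parity, hp.neg_one_pow, (hw.2 hp).neg_one_pow] using this.symm
    · have := congrFun h w
      rw [Nat.odd_add'] at hw
      simpa [parity, hp.neg_one_pow, (hw.1 hp).neg_one_pow] using this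
  have h2 : (2 : ℝ) • φ w = 0 := by rw [two_smul]; nth_rewrite 1 [hx]; simp
  simpa using h2

/-- Contracting with a letter exchanges the two terms of the Jacobi rule, so induction on the word
reduces the claim to a comparison of signs and to the empty word. -/
lemma poisson_comm {p q : ℕ} (hB : B.SeparatingLeft) (hs : B.IsSymm) (hφ : IsRegular B φ)
    (hψ : IsRegular B ψ) (hp : parity φ = (-1 : ℝ) ^ p • φ) (hq : parity ψ = (-1 : ℝ) ^ q • ψ) :
    poisson B φ ψ = -(-1 : ℝ) ^ (p * q) • poisson B ψ φ := by
  funext w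
  change poissonAt B w φ ψ = -(-1 : ℝ) ^ (p * q) • poissonAt B w ψ φ
  induction w generalizing φ ψ p q with
  | nil =>
    simp only [poissonAt]
    rw [hs.eq (sectionPart B ψ) (sectionPart B φ)]
    -- If one argument is even, its component of degree one vanishes and the rest is antisymmetric.
    -- If both are odd, their components of degree two vanish and only the symmetric form remains.
    rcases Nat.even_or_odd p with hp' | hp'
    · have : sectionPart B φ = 0 := sectionPart_eq_zero hB fun v =>
        eq_zero_of_parity hp (by simpa [weight] using (Nat.odd_add.2 (by simp [hp'])))
      simp [(hp'.mul_right q).neg_one_pow, this]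
    rcases Nat.even_or_odd q with hq' | hq'
    · have : sectionPart B ψ = 0 := sectionPart_eq_zero hB fun v =>
        eq_zero_of_parity hq (by simpa [weight] using (Nat.odd_add.2 (by simp [hq'])))
      simp [(hq'.mul_left p).neg_one_pow, this]
    · have h1 : ∀ f, φ [Sum.inr f] = 0 := fun f =>
        eq_zero_of_parity hp (by simpa [weight] using Nat.odd_add'.2 (by simp [hp']))
      have h2 : ∀ f, ψ [Sum.inr f] = 0 := fun f =>
        eq_zero_of_parity hq (by simpa [weight] using Nat.odd_add'.2 (by simp [hq']))
      simp [(hp'.mul hq').neg_one_pow, h1, h2]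
  | cons a w ih =>
    rcases a with u | f
    · simp only [poissonAt, hp, hq]
      rw [poissonAt_smul_right hB w _ (hφ.contract _) hψ,
        poissonAt_smul_right hB w _ (hψ.contract _) hφ,
        ih hφ (hψ.contract _) hp (parity_contract_section hq u),
        ih (hφ.contract _) hψ (parity_contract_section hp u) hq, smul_add, smul_smul, smul_smul,
        add_comm]
      congr 2
      · rw [mul_neg, ← pow_add, add_mul, one_mul, ← add_assoc, add_comm q, add_assoc, ← two_mul,
          pow_add, pow_mul (-1 : ℝ) 2]
        simp
      · rw [neg_mul, ← pow_add, mul_add, mul_one]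
    · simp only [poissonAt]
      rw [ih hφ (hψ.contract _) hp (parity_contract_function hq f),
        ih (hφ.contract _) hψ (parity_contract_function hp f) hq, smul_add, add_comm]

end PoissonAlgebra

/-! ### From Courant algebroid axioms to the master equation. -/

section Courant

variable {R E : Type*} [CommRing R] [Algebra ℝ R] [AddCommGroup E] [Module R E]
  {B : LinearMap.BilinForm R E} {φ ψ : Word R E → R} {n : ℕ}

lemma IsOfDegree.add (hφ : IsOfDegree B n φ) (hψ : IsOfDegree B n ψ) :
    IsOfDegree B n (φ + ψ) where
  eq_zero w hw := by simp [hφ.eq_zero w hw, hψ.eq_zero w hw]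
  add_section w w' u v := by
    simp only [Pi.add_apply, hφ.add_section, hψ.add_section]; ring
  smul_section w w' c u := by
    simp only [Pi.add_apply, hφ.smul_section, hψ.smul_section, smul_add]
  add_function w w' f g := by
    simp only [Pi.add_apply, hφ.add_function, hψ.add_function]; ring
  smul_function w w' c f := by
    simp only [Pi.add_apply, hφ.smul_function, hψ.smul_function, smul_add]
  swap_section_section w w' u v := by
    simp only [Pi.add_apply, ← hφ.swap_section_section, ← hψ.swap_section_section]; ring
  swap_section_function w w' u f := by
    simp only [Pi.add_apply, hφ.swap_section_function, hψ.swap_section_function]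
  swap_function_function w w' f g := by
    simp only [Pi.add_apply]
    rw [hφ.swap_function_function, hψ.swap_function_function]
  section_last w f u := by
    simp only [Pi.add_apply, hφ.section_last, hψ.section_last, mul_add]
  function_last w f g := by
    simp only [Pi.add_apply, hφ.function_last, hψ.function_last]; ring

/-- The Leibniz rule for a last section letter makes the value `R`-linear in that letter, hence
represented by a section. -/
lemma IsOfDegree.isPoissonFn (hrep : ∀ l : E →ₗ[R] R, ∃ u, ∀ v, B u v = l v)
    (hφ : IsOfDegree B n φ) : IsPoissonFn B φ where
  representable w := hrep
    { toFun := fun v => φ (w ++ [Sum.inl v])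
      map_add' := hφ.add_section w []
      map_smul' := hφ.section_last w }
  map_add w := hφ.add_function w []
  map_smul w := hφ.smul_function w []
  add_section := hφ.add_section
  swap_section_section := hφ.swap_section_section
  swap_section_function := hφ.swap_section_function
  swap_function_function := hφ.swap_function_function

lemma IsOfDegree.parity_eq (hφ : IsOfDegree B n φ) : parity φ = (-1 : ℝ) ^ n • φ := by
  funext w
  by_cases hw : weight w = n
  · simp [parity, hw, Algebra.smul_def]
  · simp [parity, hφ.eq_zero w hw]

/-- The axioms of a Courant algebroid imply the master equation. -/
theorem IsOfDegree.poisson_self_eq_zero (hB : B.SeparatingLeft) (hs : B.IsSymm)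
    (h : IsOfDegree B 3 φ) (hφ : IsPoissonFn B φ) (d : E → E → E) (δ : R → E)
    (hd : ∀ u v w, φ [Sum.inl u, Sum.inl v, Sum.inl w] = B (d u v) w)
    (hδ : ∀ f v, φ [Sum.inr f, Sum.inl v] = B (δ f) v)
    (jacobi : ∀ u v w, d u (d v w) = d (d u v) w + d v (d u w))
    (anchor : ∀ u v f, φ [Sum.inl (d u v), Sum.inr f] =
      φ [Sum.inl u, Sum.inr (φ [Sum.inl v, Sum.inr f])] -
        φ [Sum.inl v, Sum.inr (φ [Sum.inl u, Sum.inr f])])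
    (isotropic : ∀ f g, B (δ f) (δ g) = 0) : poisson B φ φ = 0 := by
  have weight_pos : ∀ (a : E ⊕ R) (w : Word R E), 1 ≤ weight (a :: w) := by
    rintro (a | a) w <;> simp [weight]
  -- Degree counting: two sections leave degree one, so only the section `d u v`, the Dorfman
  -- bracket, survives; the next two facts do the same for the anchor and for the gradient `δ`.
  have c_ss : ∀ u v, contract (contract φ (Sum.inl u)) (Sum.inl v) = sectionFn B (d u v) := by
    intro u v
    funext w
    match w with
    | [] => exact h.eq_zero _ (by simp [weight])
    | [Sum.inl x] => exact hd u v x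
    | [Sum.inr f] => exact h.eq_zero _ (by simp [weight])
    | Sum.inl a :: b :: w =>
      exact h.eq_zero _ (by have := weight_pos b w; simp only [weight]; omega)
    | Sum.inr a :: b :: w =>
      exact h.eq_zero _ (by have := weight_pos b w; simp only [weight]; omega)
  have c_sf : ∀ u f, contract (contract φ (Sum.inl u)) (Sum.inr f) =
      constFn (φ [Sum.inl u, Sum.inr f]) := by
    intro u f
    funext w
    match w with
    | [] => rfl
    | b :: w => exact h.eq_zero _ (by have := weight_pos b w; simp only [weight]; omega)
  have c_f : ∀ f, contract φ (Sum.inr f) = sectionFn B (δ f) := by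
    intro f
    funext w
    match w with
    | [] => exact h.eq_zero _ (by simp [weight])
    | [Sum.inl x] => exact hδ f x
    | [Sum.inr f] => exact h.eq_zero _ (by simp [weight])
    | Sum.inl a :: b :: w =>
      exact h.eq_zero _ (by have := weight_pos b w; simp only [weight]; omega)
    | Sum.inr a :: b :: w =>
      exact h.eq_zero _ (by have := weight_pos b w; simp only [weight]; omega)
  have hpar := h.parity_eq
  have p_s : ∀ u, parity (contract φ (Sum.inl u)) = contract φ (Sum.inl u) := fun u => by
    rw [parity_contract_section hpar u]; norm_num
  -- brackets of two elements of degree two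
  have K_s : ∀ u v x w,
      poissonAt B (Sum.inl x :: w) (contract φ (Sum.inl v)) (contract φ (Sum.inl u)) =
        φ (Sum.inl v :: Sum.inl (d u x) :: w) - φ (Sum.inl u :: Sum.inl (d v x) :: w) := by
    intro u v x w
    have := poissonAt_sectionFn_parity hB hs (hφ.contract (Sum.inl u)) (d v x) w
    rw [p_s] at this
    rw [poissonAt, p_s, c_ss, c_ss, poissonAt_sectionFn_right hB (hφ.contract _), this]
    simp [sub_eq_add_neg]
  have K_f : ∀ u v f w,
      poissonAt B (Sum.inr f :: w) (contract φ (Sum.inl v)) (contract φ (Sum.inl u)) =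
        φ (Sum.inl v :: Sum.inr (φ [Sum.inl u, Sum.inr f]) :: w) -
          φ (Sum.inl u :: Sum.inr (φ [Sum.inl v, Sum.inr f]) :: w) := by
    intro u v f w
    rw [poissonAt, c_sf, c_sf, poissonAt_constFn_right hB (hφ.contract _),
      poissonAt_constFn_left hB (hφ.contract _)]
    simp [sub_eq_add_neg]
  have K_nil : ∀ u v,
      poissonAt B [] (contract φ (Sum.inl v)) (contract φ (Sum.inl u)) = 0 := by
    intro u v
    have h1 : sectionPart B (contract φ (Sum.inl v)) = 0 := sectionPart_eq_zero hB fun x =>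
      h.eq_zero _ (by simp [weight])
    have h2 : ∀ u, φ [Sum.inl u] = 0 := fun u => h.eq_zero _ (by simp [weight])
    have h3 : ∀ u, φ [Sum.inl u, Sum.inr 0] = 0 := fun u => (hφ.contract (Sum.inl u)).apply_zero
    simp [poissonAt, h1, h2, h3]
  -- the bracket of `φ` with an element of degree two
  have hδd : ∀ u f v, φ [Sum.inl u, Sum.inl (δ f), Sum.inl v] =
      φ [Sum.inr (φ [Sum.inl u, Sum.inr f]), Sum.inl v] := by
    intro u f v
    -- This is `d u (δ f) = δ (u · f)`: pair it with `v`, move `δ f` to the last place by the swap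
    -- rule, and apply the anchor identity.
    have h1 := hφ.swap_section_section [Sum.inl u] [] (δ f) v
    have h2 := hd u v (δ f)
    have h3 := hφ.swap_section_function [] [] (d u v) f
    have h4 := hφ.swap_section_function [] [] v (φ [Sum.inl u, Sum.inr f])
    have h5 := hφ.swap_section_function [] [] v f
    have h6 := anchor u v f
    simp only [List.nil_append, List.cons_append] at h1 h3 h4 h5
    rw [← hδ, ← h5] at h1
    rw [hs.eq, ← hδ, ← h3] at h2
    linear_combination h1 - h2 - h6 + h4
  -- Here `{φ, {φ, u}} = 0`. Two section letters bring out the Jacobi identity, a section followed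
  -- by a function the anchor identity, and an initial function the identity `d u (δ f) = δ (u ·
  -- f)`.
  have G : ∀ u w, poissonAt B w φ (contract φ (Sum.inl u)) = 0 := by
    intro u w
    rcases w with _ | ⟨v | f, w⟩
    · have h1 : sectionPart B φ = 0 := sectionPart_eq_zero hB fun x =>
        h.eq_zero _ (by simp [weight])
      have h2 : ∀ u, φ [u] = 0 := by
        rintro (u | u) <;> exact h.eq_zero _ (by simp [weight])
      have h3 : φ [] = 0 := h.eq_zero _ (by simp [weight])
      have h4 := (hφ.contract (Sum.inl u)).apply_zero
      simpa [poissonAt, h1, h2, h3] using h4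
    · rw [poissonAt, p_s, c_ss, poissonAt_sectionFn_right hB hφ]
      rcases w with _ | ⟨x | f, w⟩
      · rw [K_nil, h.eq_zero _ (by simp [weight]), add_zero]
      · rw [K_s]
        have h1 := congrFun (c_ss (d u v) x) w
        have h2 := congrFun (c_ss v (d u x)) w
        have h3 := congrFun (c_ss u (d v x)) w
        simp only [contract_apply] at h1 h2 h3
        rw [h1, h2, h3, jacobi u v x]
        match w with
        | [] => simp [sectionFn]
        | [Sum.inl y] => simp [sectionFn]
        | [Sum.inr y] => simp [sectionFn]
        | _ :: _ :: _ => simp [sectionFn]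
      · rw [K_f]
        match w with
        | [] => rw [anchor]; ring
        | b :: w =>
          have := weight_pos b w
          rw [h.eq_zero _ (by simp only [weight]; omega),
            h.eq_zero _ (by simp only [weight]; omega),
            h.eq_zero _ (by simp only [weight]; omega)]
          ring
    · have h1 := poissonAt_sectionFn_parity hB hs (hφ.contract (Sum.inl u)) (δ f) w
      rw [p_s] at h1
      rw [poissonAt, c_sf, c_f, poissonAt_constFn_right hB hφ, h1, contract_apply]
      match w with
      | [] =>
        rw [h.eq_zero _ (by simp [weight]), h.eq_zero _ (by simp [weight])]
        simp
      | [Sum.inl v] => rw [hδd]; ring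
      | [Sum.inr v] =>
        rw [h.eq_zero _ (by simp [weight]), h.eq_zero _ (by simp [weight])]
        simp
      | Sum.inl a :: b :: w =>
        have := weight_pos b w
        rw [h.eq_zero _ (by simp only [weight]; omega),
          h.eq_zero _ (by simp only [weight]; omega)]
        simp
      | Sum.inr a :: b :: w =>
        have := weight_pos b w
        rw [h.eq_zero _ (by simp only [weight]; omega),
          h.eq_zero _ (by simp only [weight]; omega)]
        simp
  -- Gradients act trivially from the left: on functions by isotropy, on sections because the swap
  -- rule cancels `d u (δ f)` against `δ (u · f)`.
  have δ_left : ∀ f w, φ (Sum.inl (δ f) :: w) = 0 := by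
    intro f w
    match w with
    | [] => exact h.eq_zero _ (by simp [weight])
    | [Sum.inl v] => exact h.eq_zero _ (by simp [weight])
    | [Sum.inr g] =>
      have := hφ.swap_section_function [] [] (δ f) g
      simp only [List.nil_append] at this
      rw [this, hδ, isotropic]
    | [Sum.inl u, Sum.inl v] =>
      have h1 := hφ.swap_section_section [] [Sum.inl v] (δ f) u
      have h2 := hφ.swap_section_function [] [] u f
      simp only [List.nil_append] at h1 h2
      rw [← hδ, hδd, ← h2] at h1
      linear_combination h1
    | [Sum.inl u, Sum.inr v] => exact h.eq_zero _ (by simp [weight])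
    | [Sum.inr u, Sum.inl v] => exact h.eq_zero _ (by simp [weight])
    | [Sum.inr u, Sum.inr v] => exact h.eq_zero _ (by simp [weight])
    | a :: b :: c :: w =>
      have := weight_pos c w
      rcases a with a | a <;> rcases b with b | b <;>
        exact h.eq_zero _ (by simp only [weight]; omega)
  funext w
  change poissonAt B w φ φ = 0
  -- By graded symmetry, contracting `{φ, φ}` with a letter gives only multiples of the bracket of
  -- `φ` with its own contraction, which vanish by the two preceding facts.
  rcases w with _ | ⟨u | f, w⟩
  · have h1 : sectionPart B φ = 0 := sectionPart_eq_zero hB fun x =>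
      h.eq_zero _ (by simp [weight])
    simp [poissonAt, h1]
  · have h1 := congrFun (poisson_comm hB hs (hφ.contract _).toIsRegular hφ.toIsRegular
      (parity_contract_section hpar u) hpar) w
    simp only [poisson, Pi.smul_apply] at h1
    rw [poissonAt, hpar, poissonAt_smul_right hB w _ (hφ.contract _).toIsRegular hφ.toIsRegular,
      h1, G]
    simp
  · have h1 := congrFun (poisson_comm hB hs (hφ.contract _).toIsRegular hφ.toIsRegular
      (parity_contract_function hpar f) hpar) w
    simp only [poisson, Pi.smul_apply] at h1
    rw [poissonAt, h1, c_f, poissonAt_sectionFn_right hB hφ, δ_left]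
    simp

end Courant

/-! ### Lie–Rinehart structures, their deformations and their cubic functions. -/

section LieRinehart

variable {R : Type*} [CommRing R] [Algebra ℝ R] {L L' E : Type*}
  [AddCommGroup L] [Module R L] [AddCommGroup L'] [Module R L'] [AddCommGroup E] [Module R E]

/-- A Lie–Rinehart structure on the `R`-module `L`. -/
structure IsLieRinehart (br : L → L → L) (ρ : L →ₗ[R] Derivation ℝ R R) : Prop where
  add_left : ∀ X Y Z, br (X + Y) Z = br X Z + br Y Z
  skew : ∀ X Y, br X Y = -br Y X
  jacobi : ∀ X Y Z, br X (br Y Z) = br (br X Y) Z + br Y (br X Z)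
  leibniz : ∀ X (f : R) Y, br X (f • Y) = f • br X Y + ρ X f • Y
  anchor_bracket : ∀ X Y f, ρ (br X Y) f = ρ X (ρ Y f) - ρ Y (ρ X f)

/-- The deformation of a bracket by an endomorphism. -/
def deformBracket (br : L → L → L) (N : L →ₗ[R] L) (X Y : L) : L :=
  br (N X) Y + br X (N Y) - N (br X Y)

namespace IsLieRinehart

variable {br : L → L → L} {ρ : L →ₗ[R] Derivation ℝ R R} (h : IsLieRinehart br ρ)

include h

lemma add_right (X Y Z : L) : br X (Y + Z) = br X Y + br X Z := by
  rw [h.skew, h.add_left, neg_add, ← h.skew, ← h.skew]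

lemma leibniz_left (f : R) (X Y : L) : br (f • X) Y = f • br X Y - ρ Y f • X := by
  rw [h.skew, h.leibniz, h.skew Y X]; module

/-- Derivations kill real constants, so the Leibniz rule gives real homogeneity. -/
lemma smul_right (c : ℝ) (X Y : L) :
    br X (algebraMap ℝ R c • Y) = algebraMap ℝ R c • br X Y := by
  rw [h.leibniz, Derivation.map_algebraMap, zero_smul, add_zero]

lemma smul_left (c : ℝ) (X Y : L) :
    br (algebraMap ℝ R c • X) Y = algebraMap ℝ R c • br X Y := by
  rw [h.leibniz_left, Derivation.map_algebraMap, zero_smul, sub_zero]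

lemma neg_right (X Y : L) : br X (-Y) = -br X Y := by
  simpa using h.smul_right (-1) X Y

lemma neg_left (X Y : L) : br (-X) Y = -br X Y := by
  simpa using h.smul_left (-1) X Y

lemma sub_right (X Y Z : L) : br X (Y - Z) = br X Y - br X Z := by
  rw [sub_eq_add_neg, h.add_right, h.neg_right, sub_eq_add_neg]

lemma sub_left (X Y Z : L) : br (X - Y) Z = br X Z - br Y Z := by
  rw [sub_eq_add_neg, h.add_left, h.neg_left, sub_eq_add_neg]

/-- An endomorphism without torsion deforms a Lie–Rinehart structure. -/
theorem deform {N : L →ₗ[R] L} (hN : ∀ X Y, br (N X) (N Y) = N (deformBracket br N X Y)) :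
    IsLieRinehart (deformBracket br N) (ρ ∘ₗ N) where
  add_left X Y Z := by
    simp only [deformBracket, map_add, h.add_left]; abel
  skew X Y := by
    simp only [deformBracket]
    rw [h.skew (N X) Y, h.skew X (N Y), h.skew X Y, map_neg]; abel
  jacobi X Y Z := by
    -- The torsion identity solved for the terms with an outer `N`.
    have e : ∀ X Y, N (br (N X) Y) + N (br X (N Y)) = br (N X) (N Y) + N (N (br X Y)) := by
      intro X Y
      rw [hN]; simp only [deformBracket, map_add, map_sub]; abel
    have e1 := e X (br Y Z)
    have e2 := e (br X Y) Z
    have e3 := e Y (br X Z)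
    have j1 := h.jacobi (N X) (N Y) Z
    have j2 := h.jacobi (N X) Y (N Z)
    have j3 := h.jacobi X (N Y) (N Z)
    have j4 := congrArg N (h.jacobi (N X) Y Z)
    have j5 := congrArg N (h.jacobi X (N Y) Z)
    have j6 := congrArg N (h.jacobi X Y (N Z))
    have j7 := congrArg (fun x => N (N x)) (h.jacobi X Y Z)
    have n1 := hN X Y
    have n2 := hN X Z
    have n3 := hN Y Z
    simp only [deformBracket] at n1 n2 n3 ⊢
    simp only [← n1, ← n2, ← n3, h.add_left, h.add_right, h.sub_left, h.sub_right, map_add,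
      map_sub] at e1 e2 e3 j1 j2 j3 j4 j5 j6 j7 ⊢
    -- Jacobi identities with `N` in two slots, minus `N` of those with `N` in one slot, plus `N²`
    -- of the plain one; the torsion identities for one entry and the bracket of the other two
    -- correct the rest.
    linear_combination (norm := module) j1 + j2 + j3 - j4 - j5 - j6 + j7 + e1 - e2 - e3
  leibniz X f Y := by
    simp only [deformBracket, map_smul, h.leibniz, map_add, LinearMap.comp_apply]
    module
  anchor_bracket X Y f := by
    simp only [LinearMap.comp_apply]
    rw [← hN, h.anchor_bracket]

/-- The double deformation is `[N²X, Y] + [X, N²Y] + N²[X, Y]` plus twice `[NX, NY] - N[NX, Y] -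
N[X, NY]`. The first part is `3c [X, Y]`, and vanishing torsion makes the second `-2c [X, Y]`. -/
lemma deform_deform {N : L →ₗ[R] L} (hN : ∀ X Y, br (N X) (N Y) = N (deformBracket br N X Y))
    {c : ℝ} (hc : ∀ X, N (N X) = algebraMap ℝ R c • X) (X Y : L) :
    deformBracket (deformBracket br N) N X Y = algebraMap ℝ R c • br X Y := by
  have h1 := hN X Y
  simp only [deformBracket, map_add, map_sub, hc, h.smul_left, h.smul_right] at h1 ⊢
  linear_combination (norm := module) (2 : R) • h1

end IsLieRinehart

/-! ### Splittings -/

/-- An identification of `(E, B)` with the sum of `L` and its dual `L'`. -/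
structure IsSplitting (B : LinearMap.BilinForm R E) (p : L' →ₗ[R] L →ₗ[R] R) (a : E →ₗ[R] L)
    (b : E →ₗ[R] L') : Prop where
  perfect : p.IsPerfPair
  bijective : Function.Bijective (a.prod b)
  form : ∀ u v, B u v = p (b u) (a v) + p (b v) (a u)

namespace IsSplitting

variable {B : LinearMap.BilinForm R E} {p : L' →ₗ[R] L →ₗ[R] R} {a : E →ₗ[R] L}
  {b : E →ₗ[R] L'} (h : IsSplitting B p a b)

include h

/-- Exchanging the summands lets every statement about a structure on `L` apply to one on `L'`. -/
lemma symm : IsSplitting B p.flip b a where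
  perfect := have := h.perfect; inferInstance
  bijective := by
    have := (Equiv.prodComm L L').bijective.comp h.bijective
    exact this
  form u v := by rw [h.form, add_comm]; rfl

lemma exists_eq (X : L) (ξ : L') : ∃ u, a u = X ∧ b u = ξ := by
  obtain ⟨u, hu⟩ := h.bijective.2 (X, ξ)
  exact ⟨u, congrArg Prod.fst hu, congrArg Prod.snd hu⟩

lemma ext_left {X Y : L} (hXY : ∀ ξ, p ξ X = p ξ Y) : X = Y :=
  h.perfect.bijective_right.1 (LinearMap.ext hXY)

lemma ext_right {ξ η : L'} (hξ : ∀ X, p ξ X = p η X) : ξ = η :=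
  h.perfect.bijective_left.1 (LinearMap.ext hξ)

lemma ext {u v : E} (ha : a u = a v) (hb : ∀ X, p (b u) X = p (b v) X) : u = v :=
  h.bijective.1 (Prod.ext ha (h.ext_right hb))

lemma isSymm : B.IsSymm := ⟨fun u v => by simp only [h.form];  ring⟩

lemma separatingLeft : B.SeparatingLeft := by
  intro u hu
  refine h.ext (h.ext_left fun ξ => ?_) fun X => ?_
  · obtain ⟨v, h1, h2⟩ := h.exists_eq 0 ξ
    simpa [h.form, h1, h2] using hu v
  · obtain ⟨v, h1, h2⟩ := h.exists_eq X 0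
    simpa [h.form, h1, h2] using hu v

/-- Restrict the functional to each summand and represent each restriction by the perfect pairing;
the part on `L` yields the component in `L'`, and conversely. -/
lemma representable (l : E →ₗ[R] R) : ∃ u, ∀ v, B u v = l v := by
  let e := LinearEquiv.ofBijective _ h.bijective
  obtain ⟨ξ, hξ⟩ := h.perfect.bijective_left.2 (l ∘ₗ e.symm.toLinearMap ∘ₗ LinearMap.inl R L L')
  obtain ⟨X, hX⟩ := h.perfect.bijective_right.2 (l ∘ₗ e.symm.toLinearMap ∘ₗ LinearMap.inr R L L')
  obtain ⟨u, rfl, rfl⟩ := h.exists_eq X ξ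
  refine ⟨u, fun v => ?_⟩
  have h1 := LinearMap.congr_fun hξ (a v)
  have h2 := LinearMap.congr_fun hX (b v)
  simp only [LinearMap.flip_apply, LinearMap.comp_apply] at h1 h2
  rw [h.form, h1, h2, ← map_add, ← map_add]
  congr 1
  have : (LinearMap.inl R L L') (a v) + (LinearMap.inr R L L') (b v) = e v := by
    simp [e]
  rw [this]
  exact e.symm_apply_apply v

end IsSplitting

/-! ### The function of a Lie–Rinehart structure -/

variable {B : LinearMap.BilinForm R E} {p : L' →ₗ[R] L →ₗ[R] R} {a : E →ₗ[R] L}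
  {b : E →ₗ[R] L'} {br : L → L → L} {ρ : L →ₗ[R] Derivation ℝ R R}

lemma algebroidFn_eq_zero {br : L → L → L} {ρ : L → R → R} {p : L' → L → R} {a : E → L}
    {b : E → L'} {w : Word R E} (hw : weight w ≠ 3) : algebroidFn br ρ p a b w = 0 := by
  rcases w with _ | ⟨x | x, _ | ⟨y | y, _ | ⟨z | z, _ | ⟨t, w⟩⟩⟩⟩ <;>
    simp [algebroidFn, weight] at hw ⊢

/-- Skew-symmetry gives the swap of two sections and the Leibniz rule gives tensoriality in the last
letter. The Jacobi identity and the compatibility of the anchor belong to the master equation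
instead. -/
theorem IsLieRinehart.isOfDegree (h : IsLieRinehart br ρ) (hs : IsSplitting B p a b) :
    IsOfDegree B 3 (algebroidFn br (fun X f => ρ X f) (fun ξ X => p ξ X) a b) where
  eq_zero w hw := algebroidFn_eq_zero hw
  add_section w w' u v := by
    by_cases hw : weight w + weight w' = 2
    · obtain ⟨h1, h2⟩ | ⟨h1, h2⟩ | ⟨h1, h2⟩ : (weight w = 0 ∧ weight w' = 2) ∨
        (weight w = 1 ∧ weight w' = 1) ∨ (weight w = 2 ∧ weight w' = 0) := by omega
      · obtain rfl := weight_eq_zero h1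
        obtain ⟨x, y, rfl⟩ | ⟨f, rfl⟩ := weight_eq_two h2
        · simp [algebroidFn, h.add_left]; ring
        · simp [algebroidFn]
      · obtain ⟨x, rfl⟩ := weight_eq_one h1
        obtain ⟨y, rfl⟩ := weight_eq_one h2
        simp [algebroidFn, h.add_left, h.add_right]; ring
      · obtain rfl := weight_eq_zero h2
        obtain ⟨x, y, rfl⟩ | ⟨f, rfl⟩ := weight_eq_two h1
        · simp [algebroidFn, h.add_right]; ring
        · simp [algebroidFn]
    · rw [algebroidFn_eq_zero, algebroidFn_eq_zero, algebroidFn_eq_zero, add_zero] <;>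
        simp only [weight_append, weight] <;> omega
  smul_section w w' c u := by
    by_cases hw : weight w + weight w' = 2
    · obtain ⟨h1, h2⟩ | ⟨h1, h2⟩ | ⟨h1, h2⟩ : (weight w = 0 ∧ weight w' = 2) ∨
        (weight w = 1 ∧ weight w' = 1) ∨ (weight w = 2 ∧ weight w' = 0) := by omega
      · obtain rfl := weight_eq_zero h1
        obtain ⟨x, y, rfl⟩ | ⟨f, rfl⟩ := weight_eq_two h2
        · simp [algebroidFn, h.smul_left, Algebra.smul_def]; ring
        · simp [algebroidFn, Algebra.smul_def]
      · obtain ⟨x, rfl⟩ := weight_eq_one h1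
        obtain ⟨y, rfl⟩ := weight_eq_one h2
        simp [algebroidFn, h.smul_left, h.smul_right, Algebra.smul_def]; ring
      · obtain rfl := weight_eq_zero h2
        obtain ⟨x, y, rfl⟩ | ⟨f, rfl⟩ := weight_eq_two h1
        · simp [algebroidFn, h.smul_right, Algebra.smul_def]; ring
        · simp [algebroidFn, Algebra.smul_def]
    · rw [algebroidFn_eq_zero, algebroidFn_eq_zero, smul_zero] <;>
        simp only [weight_append, weight] <;> omega
  add_function w w' f g := by
    by_cases hw : weight w + weight w' = 1
    · obtain ⟨h1, h2⟩ | ⟨h1, h2⟩ : (weight w = 0 ∧ weight w' = 1) ∨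
        (weight w = 1 ∧ weight w' = 0) := by omega
      · obtain rfl := weight_eq_zero h1
        obtain ⟨x, rfl⟩ := weight_eq_one h2
        simp [algebroidFn]
      · obtain rfl := weight_eq_zero h2
        obtain ⟨x, rfl⟩ := weight_eq_one h1
        simp [algebroidFn]
    · rw [algebroidFn_eq_zero, algebroidFn_eq_zero, algebroidFn_eq_zero, add_zero] <;>
        simp only [weight_append, weight] <;> omega
  smul_function w w' c f := by
    by_cases hw : weight w + weight w' = 1
    · obtain ⟨h1, h2⟩ | ⟨h1, h2⟩ : (weight w = 0 ∧ weight w' = 1) ∨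
        (weight w = 1 ∧ weight w' = 0) := by omega
      · obtain rfl := weight_eq_zero h1
        obtain ⟨x, rfl⟩ := weight_eq_one h2
        simp [algebroidFn]
      · obtain rfl := weight_eq_zero h2
        obtain ⟨x, rfl⟩ := weight_eq_one h1
        simp [algebroidFn]
    · rw [algebroidFn_eq_zero, algebroidFn_eq_zero, smul_zero] <;>
        simp only [weight_append, weight] <;> omega
  swap_section_section w w' u v := by
    by_cases hw : weight w + weight w' = 1
    · obtain ⟨h1, h2⟩ | ⟨h1, h2⟩ : (weight w = 0 ∧ weight w' = 1) ∨
        (weight w = 1 ∧ weight w' = 0) := by omega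
      · obtain rfl := weight_eq_zero h1
        obtain ⟨x, rfl⟩ := weight_eq_one h2
        simp only [algebroidFn, hs.form, List.nil_append, map_add]
        rw [h.skew (a u) (a v), map_neg]; ring
      · obtain rfl := weight_eq_zero h2
        obtain ⟨x, rfl⟩ := weight_eq_one h1
        simp only [algebroidFn, hs.form, List.nil_append, List.cons_append, map_add]
        rw [h.skew (a u) (a v), map_neg]; ring
    · rw [algebroidFn_eq_zero, algebroidFn_eq_zero, algebroidFn_eq_zero, add_zero] <;>
        simp only [weight_append, weight] <;> omega
  swap_section_function w w' u f := by
    by_cases hw : weight w + weight w' = 0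
    · obtain rfl := weight_eq_zero (show weight w = 0 by omega)
      obtain rfl := weight_eq_zero (show weight w' = 0 by omega)
      rfl
    · rw [algebroidFn_eq_zero, algebroidFn_eq_zero] <;>
        simp only [weight_append, weight] <;> omega
  swap_function_function w w' f g := by
    rw [algebroidFn_eq_zero, algebroidFn_eq_zero] <;>
      simp only [weight_append, weight] <;> omega
  section_last w f u := by
    by_cases hw : weight w = 2
    · obtain ⟨x, y, rfl⟩ | ⟨g, rfl⟩ := weight_eq_two hw
      · simp [algebroidFn, h.leibniz]; ring
      · simp [algebroidFn]
    · rw [algebroidFn_eq_zero, algebroidFn_eq_zero, mul_zero] <;>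
        simp only [weight_append, weight] <;> omega
  function_last w f g := by
    by_cases hw : weight w = 1
    · obtain ⟨x, rfl⟩ := weight_eq_one hw
      simp [algebroidFn]
    · rw [algebroidFn_eq_zero, algebroidFn_eq_zero, algebroidFn_eq_zero, mul_zero, mul_zero,
        add_zero] <;> simp only [weight_append, weight] <;> omega

theorem IsLieRinehart.isPoissonFn (h : IsLieRinehart br ρ) (hs : IsSplitting B p a b) :
    IsPoissonFn B (algebroidFn br (fun X f => ρ X f) (fun ξ X => p ξ X) a b) :=
  (h.isOfDegree hs).isPoissonFn hs.representable

/-- The represented bracket on `E` is the Dorfman bracket of `L ⊕ L'`, whose Courant axioms reduce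
to the Lie–Rinehart axioms. -/
theorem IsLieRinehart.poisson_self (h : IsLieRinehart br ρ) (hs : IsSplitting B p a b) :
    poisson B (algebroidFn br (fun X f => ρ X f) (fun ξ X => p ξ X) a b)
      (algebroidFn br (fun X f => ρ X f) (fun ξ X => p ξ X) a b) = 0 := by
  have hφ := h.isPoissonFn hs
  choose d hd using fun u v => hφ.representable [Sum.inl u, Sum.inl v]
  choose δ hδ using fun f => hφ.representable [Sum.inr f]
  simp only [List.cons_append, List.nil_append] at hd hδ
  -- Testing against sections of a single summand isolates the components: `δ f` is the differential
  -- of `f` in `L'`, and `d u v` has components `[X, Y]` and `L_X η - i_Y dξ`.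
  have hδa : ∀ f, a (δ f) = 0 := fun f => hs.ext_left fun ξ => by
    obtain ⟨v, h1, h2⟩ := hs.exists_eq 0 ξ
    simpa [hs.form, h1, h2, algebroidFn] using hδ f v
  have hδb : ∀ f X, p (b (δ f)) X = ρ X f := fun f X => by
    obtain ⟨v, h1, h2⟩ := hs.exists_eq X 0
    simpa [hs.form, h1, h2, algebroidFn] using hδ f v
  have br0 : ∀ X, br X 0 = 0 := fun X => by simpa using h.smul_right 0 X 0
  have hda : ∀ u v, a (d u v) = br (a u) (a v) := fun u v => hs.ext_left fun ξ => by
    obtain ⟨w, h1, h2⟩ := hs.exists_eq 0 ξ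
    simpa [hs.form, h1, h2, algebroidFn, br0] using hd u v w
  have hdb : ∀ u v X, p (b (d u v)) X = ρ (a u) (p (b v) X) - p (b v) (br (a u) X) -
      (ρ (a v) (p (b u) X) - ρ X (p (b u) (a v)) - p (b u) (br (a v) X)) := fun u v X => by
    obtain ⟨w, h1, h2⟩ := hs.exists_eq X 0
    simpa [hs.form, h1, h2, algebroidFn] using hd u v w
  refine (h.isOfDegree hs).poisson_self_eq_zero hs.separatingLeft hs.isSymm hφ d δ
    (fun u v w => (hd u v w).symm) (fun f v => (hδ f v).symm) ?_ ?_ ?_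
  · intro u v w
    refine hs.ext ?_ fun X => ?_
    · simp only [map_add, hda, h.jacobi (a u)]
    · have j1 := congrArg (p (b w)) (h.jacobi (a u) (a v) X)
      have j2 := congrArg (p (b v)) (h.jacobi (a u) (a w) X)
      have j3 := congrArg (p (b u)) (h.jacobi (a v) (a w) X)
      have a1 := h.anchor_bracket (a u) (a v) (p (b w) X)
      have a2 := h.anchor_bracket (a u) (a w) (p (b v) X)
      have a3 := h.anchor_bracket (a v) (a w) (p (b u) X)
      have a4 := h.anchor_bracket (a u) X (p (b v) (a w))
      have a5 := h.anchor_bracket (a v) X (p (b u) (a w))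
      have a6 := h.anchor_bracket (a w) X (p (b u) (a v))
      simp only [map_add] at j1 j2 j3
      simp only [map_add, LinearMap.add_apply, hda, hdb, map_sub, a1, a2, a3, a4, a5, a6, j1, j2, j3]
      ring
  · intro u v f
    simp only [algebroidFn, hda, h.anchor_bracket]
  · intro f g
    simp [hs.form, hδa]

variable {N : L →ₗ[R] L} {T : E → E}

/-- The derivation of a skew-symmetric endomorphism preserving the splitting deforms the bracket
and the anchor. -/
theorem derivation_algebroidFn
    (ha : ∀ u, a (T u) = N (a u)) (hb : ∀ u X, p (b (T u)) X = -p (b u) (N X)) :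
    derivation T (algebroidFn br (fun X f => ρ X f) (fun ξ X => p ξ X) a b) =
      algebroidFn (deformBracket br N) (fun X f => (ρ ∘ₗ N) X f) (fun ξ X => p ξ X) a b := by
  funext w
  by_cases hw : weight w = 3
  · obtain ⟨u, v, x, rfl⟩ | ⟨u, f, rfl⟩ | ⟨f, u, rfl⟩ := weight_eq_three hw
    · simp [derivation, derivationAt, algebroidFn, ha, hb, deformBracket]
      ring
    · simp [derivation, derivationAt, algebroidFn, ha]
    · simp [derivation, derivationAt, algebroidFn, ha]
  · rw [algebroidFn_eq_zero hw,
      derivation_eq_zero T fun w' hw' => algebroidFn_eq_zero (by rwa [hw'])]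

/-- The deformation by an endomorphism of square `c` and without torsion, iterated twice. -/
theorem derivation_derivation_algebroidFn (h : IsLieRinehart br ρ)
    (hN : ∀ X Y, br (N X) (N Y) = N (deformBracket br N X Y))
    {c : ℝ} (hc : ∀ X, N (N X) = algebraMap ℝ R c • X)
    (ha : ∀ u, a (T u) = N (a u)) (hb : ∀ u X, p (b (T u)) X = -p (b u) (N X)) :
    derivation T (derivation T (algebroidFn br (fun X f => ρ X f) (fun ξ X => p ξ X) a b)) =
      c • algebroidFn br (fun X f => ρ X f) (fun ξ X => p ξ X) a b := by
  rw [derivation_algebroidFn ha hb, derivation_algebroidFn ha hb]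
  have hbr : deformBracket (deformBracket br N) N = fun X Y => algebraMap ℝ R c • br X Y :=
    funext₂ (h.deform_deform hN hc)
  rw [hbr]
  funext w
  simp only [LinearMap.comp_apply, hc, map_smul, Derivation.smul_apply, Pi.smul_apply]
  by_cases hw : weight w = 3
  · obtain ⟨u, v, x, rfl⟩ | ⟨u, f, rfl⟩ | ⟨f, u, rfl⟩ := weight_eq_three hw
    · simp [algebroidFn, Algebra.smul_def]
      ring
    · simp [algebroidFn, Algebra.smul_def]
    · simp [algebroidFn, Algebra.smul_def]
  · rw [algebroidFn_eq_zero hw, algebroidFn_eq_zero hw, smul_zero]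

end LieRinehart

/-! ### Perfect duality between sections of a bundle and of its dual. -/

section Pairing

open Topology

variable {EM : Type*} [NormedAddCommGroup EM] [NormedSpace ℝ EM]
  {H : Type*} [TopologicalSpace H] {I : ModelWithCorners ℝ EM H}
  {M : Type*} [TopologicalSpace M] [ChartedSpace H M]
  {F : Type*} [NormedAddCommGroup F] [NormedSpace ℝ F]
  {V : M → Type*} [TopologicalSpace (TotalSpace F V)]
  [∀ x, AddCommGroup (V x)] [∀ x, Module ℝ (V x)] [∀ x, TopologicalSpace (V x)]
  [FiberBundle F V] [VectorBundle ℝ F V]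

@[simp] lemma section_smul_apply (f : C^∞⟮I, M; ℝ⟯) (s : Cₛ^∞⟮I; F, V⟯) (x : M) :
    (f • s) x = f x • s x := rfl

lemma section_sum_apply {ι : Type*} (t : Finset ι) (s : ι → Cₛ^∞⟮I; F, V⟯) (x : M) :
    (∑ i ∈ t, s i) x = ∑ i ∈ t, s i x := by
  have := congrFun (map_sum (ContMDiffSection.coeAddHom I F ∞ V) s t) x
  rwa [Finset.sum_apply] at this

lemma function_sum_apply {ι : Type*} (t : Finset ι) (f : ι → C^∞⟮I, M; ℝ⟯) (x : M) :
    (∑ i ∈ t, f i) x = ∑ i ∈ t, f i x := by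
  have := congrFun (map_sum (ContMDiffMap.coeFnAddMonoidHom (I := I) (N := M)
    (I' := 𝓘(ℝ, ℝ)) (G := ℝ) (n := ∞)) f t) x
  simpa using this

@[simp] lemma pairing_apply (ξ : DualSection I F V) (X : Cₛ^∞⟮I; F, V⟯) (x : M) :
    pairing ξ X x = ξ x (X x) := rfl

variable (I F V) in
/-- The duality pairing as a bilinear map. -/
noncomputable def pairingMap : DualSection I F V →ₗ[C^∞⟮I, M; ℝ⟯] Cₛ^∞⟮I; F, V⟯ →ₗ[C^∞⟮I, M; ℝ⟯] C^∞⟮I, M; ℝ⟯ :=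
  LinearMap.mk₂ _ pairing (fun _ _ _ => by ext x; rfl) (fun _ _ _ => by ext x; rfl)
    (fun ξ X Y => by ext x; exact map_add (ξ x) (X x) (Y x))
    (fun f ξ X => by ext x; exact map_smul (ξ x) (f x) (X x))

@[simp] lemma pairingMap_apply (ξ : DualSection I F V) (X : Cₛ^∞⟮I; F, V⟯) :
    pairingMap I F V ξ X = pairing ξ X := rfl

variable [FiniteDimensional ℝ EM] [IsManifold I ∞ M] [T2Space M] [FiniteDimensional ℝ F]
  [ContMDiffVectorBundle ∞ F V I]

variable (I F V) in
/-- Near each point there are dual frames of `V` and `V*` by globally defined sections. -/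
lemma exists_dual_frames (x₀ : M) : ∃ (n : ℕ) (s : Fin n → Cₛ^∞⟮I; F, V⟯)
    (σ : Fin n → DualSection I F V), ∀ᶠ y in 𝓝 x₀, ∀ v : V y, ∑ i, σ i y v • s i y = v := by
  let e := trivializationAt F V x₀
  let e' := trivializationAt (F →L[ℝ] ℝ) (DualBundle V) x₀
  have hx₀ : e.baseSet ∈ 𝓝 x₀ :=
    e.open_baseSet.mem_nhds (FiberBundle.mem_baseSet_trivializationAt F V x₀)
  obtain ⟨χ, -, hχ⟩ := (SmoothBumpFunction.nhds_basis_tsupport (I := I) x₀).mem_iff.1 hx₀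
  let b := Module.finBasis ℝ F
  let τ : Fin (Module.finrank ℝ F) → ∀ y, DualBundle V y := fun i y =>
    (LinearMap.toContinuousLinearMap (b.coord i)).comp (e.continuousLinearMapAt ℝ y)
  have hτ : ∀ i, ContMDiffOn I (I.prod 𝓘(ℝ, F →L[ℝ] ℝ)) ∞
      (fun y => TotalSpace.mk' (F →L[ℝ] ℝ) y (τ i y)) e.baseSet := by
    intro i
    have hb : e'.baseSet = e.baseSet := by simp [e', e, hom_trivializationAt_baseSet]
    rw [← hb, e'.contMDiffOn_section_baseSet_iff, hb]
    -- Read in the trivialization, `τ i` is a constant covector.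
    refine (contMDiffOn_const (c := LinearMap.toContinuousLinearMap (b.coord i))).congr ?_
    intro y hy
    ext v
    have hy' : y ∈ (trivializationAt F V x₀).baseSet := hy
    simp [e', τ, e, hom_trivializationAt_apply, ContinuousLinearMap.inCoordinates, hy']
  refine ⟨_, fun i => ⟨fun y => χ y • e.localFrame b i y,
    ContMDiffOn.smul_section_of_tsupport χ.contMDiff.contMDiffOn e.open_baseSet hχ
      (e.contMDiffOn_localFrame_baseSet ∞ b i)⟩,
    fun i => ⟨fun y => χ y • τ i y,
    ContMDiffOn.smul_section_of_tsupport χ.contMDiff.contMDiffOn e.open_baseSet hχ (hτ i)⟩, ?_⟩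
  filter_upwards [hx₀, χ.eventuallyEq_one] with y hy hχy v
  -- Both frames carry the cut-off `χ`, which equals one near `x₀`, so duality is undisturbed there.
  change ∑ i, (χ y • τ i y) v • (χ y • e.localFrame b i y) = v
  simp only [hχy, Pi.one_apply, one_smul, τ, ContinuousLinearMap.comp_apply,
    e.localFrame_apply_of_mem_baseSet b hy, Bundle.Trivialization.basisAt, Module.Basis.map_apply]
  simp only [← map_smul, ← map_sum]
  have := b.sum_repr (e.linearEquivAt ℝ y hy v)
  rw [LinearEquiv.symm_apply_eq]
  convert this using 3
  simp [hy]

/-- Sections separate the covectors at a point. -/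
lemma dual_ext {y : M} {α β : DualBundle V y} (h : ∀ X : Cₛ^∞⟮I; F, V⟯, α (X y) = β (X y)) :
    α = β := by
  obtain ⟨n, s, σ, hs⟩ := exists_dual_frames I F V y
  ext v
  rw [← hs.self_of_nhds v, map_sum, map_sum]
  exact Finset.sum_congr rfl fun i _ => by rw [map_smul, map_smul, h]

/-- Sections of the dual bundle separate the vectors at a point. -/
lemma vector_ext {y : M} {v w : V y} (h : ∀ ξ : DualSection I F V, ξ y v = ξ y w) : v = w := by
  obtain ⟨n, s, σ, hs⟩ := exists_dual_frames I F V y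
  rw [← hs.self_of_nhds v, ← hs.self_of_nhds w]
  exact Finset.sum_congr rfl fun i _ => by rw [h]

/-- A bump function supported in a given neighbourhood. -/
lemma exists_bump {x₀ : M} {U : Set M} (hU : U ∈ 𝓝 x₀) :
    ∃ χ : C^∞⟮I, M; ℝ⟯, (∀ᶠ y in 𝓝 x₀, χ y = 1) ∧ ∀ y ∉ U, χ y = 0 := by
  obtain ⟨χ, -, hχ⟩ := (SmoothBumpFunction.nhds_basis_tsupport (I := I) x₀).mem_iff.1 hU
  exact ⟨⟨χ, χ.contMDiff⟩, χ.eventuallyEq_one,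
    fun y hy => image_eq_zero_of_notMem_tsupport fun h => hy (hχ h)⟩

/-- Linearity over smooth functions makes `l` local: near a point it is evaluation at `∑ l (σ i) • s
i` for a dual frame. Vectors are separated by dual sections, so the local representatives agree and
glue. -/
lemma exists_section_of_functional
    (l : DualSection I F V →ₗ[C^∞⟮I, M; ℝ⟯] C^∞⟮I, M; ℝ⟯) :
    ∃ X : Cₛ^∞⟮I; F, V⟯, ∀ ξ, pairing ξ X = l ξ := by
  have loc : ∀ x₀, ∃ X : Cₛ^∞⟮I; F, V⟯, ∀ᶠ y in 𝓝 x₀, ∀ ξ : DualSection I F V,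
      ξ y (X y) = l ξ y := by
    intro x₀
    obtain ⟨n, s, σ, hs⟩ := exists_dual_frames I F V x₀
    obtain ⟨χ, h1, h0⟩ := exists_bump (I := I) hs
    refine ⟨∑ i, l (σ i) • s i, ?_⟩
    filter_upwards [h1] with y hy ξ
    -- An identity on all of `M`, to which `l` can be applied: `χ` vanishes wherever the frames fail
    -- to be dual.
    have key : χ • ξ = ∑ i, (χ * pairing ξ (s i)) • σ i := by
      ext1 z
      rw [section_sum_apply]
      by_cases hz : ∀ v : V z, ∑ i, σ i z v • s i z = v
      · ext v
        simp only [section_smul_apply, ContMDiffMap.coe_mul, Pi.mul_apply, pairing_apply,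
          sum_apply, smul_apply]
        conv_lhs => rw [← hz v]
        simp only [map_sum, map_smul, smul_eq_mul, Finset.mul_sum]
        exact Finset.sum_congr rfl fun i _ => by ring
      · simp [h0 z hz]
    have := DFunLike.congr_fun (congrArg l key) y
    simp only [map_smul, map_sum, smul_eq_mul, ContMDiffMap.coe_mul, Pi.mul_apply, hy,
      function_sum_apply, one_mul, pairing_apply] at this
    rw [this, section_sum_apply, map_sum]
    refine Finset.sum_congr rfl fun i _ => ?_
    rw [section_smul_apply, map_smul, smul_eq_mul, mul_comm]
  choose X hX using loc
  -- The diagonal of the local representatives; by uniqueness it agrees with the smooth section `X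
  -- x₀` near `x₀`, so no partition of unity is needed.
  refine ⟨⟨fun x => X x x, fun x₀ => ?_⟩, fun ξ => ?_⟩
  · refine ((X x₀).contMDiff x₀).congr_of_eventuallyEq ?_
    filter_upwards [hX x₀] with y hy
    rw [vector_ext fun ξ => ((hX y).self_of_nhds ξ).trans (hy ξ).symm]
  · ext x
    exact (hX x).self_of_nhds ξ

/-- The same localization with the two frames interchanged. -/
lemma exists_dualSection_of_functional
    (l : Cₛ^∞⟮I; F, V⟯ →ₗ[C^∞⟮I, M; ℝ⟯] C^∞⟮I, M; ℝ⟯) :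
    ∃ ξ : DualSection I F V, ∀ X, pairing ξ X = l X := by
  have loc : ∀ x₀, ∃ ξ : DualSection I F V, ∀ᶠ y in 𝓝 x₀, ∀ X : Cₛ^∞⟮I; F, V⟯,
      ξ y (X y) = l X y := by
    intro x₀
    obtain ⟨n, s, σ, hs⟩ := exists_dual_frames I F V x₀
    obtain ⟨χ, h1, h0⟩ := exists_bump (I := I) hs
    refine ⟨∑ i, l (s i) • σ i, ?_⟩
    filter_upwards [h1] with y hy X
    have key : χ • X = ∑ i, (χ * pairing (σ i) X) • s i := by
      ext1 z
      rw [section_sum_apply]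
      by_cases hz : ∀ v : V z, ∑ i, σ i z v • s i z = v
      · simp only [section_smul_apply, ContMDiffMap.coe_mul, Pi.mul_apply, pairing_apply]
        conv_lhs => rw [← hz (X z)]
        simp only [Finset.smul_sum, smul_smul]
      · simp [h0 z hz]
    have := DFunLike.congr_fun (congrArg l key) y
    simp only [map_smul, map_sum, smul_eq_mul, ContMDiffMap.coe_mul, Pi.mul_apply, hy,
      function_sum_apply, one_mul, pairing_apply] at this
    rw [this, section_sum_apply, sum_apply]
    refine Finset.sum_congr rfl fun i _ => ?_
    rw [section_smul_apply, smul_apply, smul_eq_mul, mul_comm]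
  choose ξ hξ using loc
  refine ⟨⟨fun x => ξ x x, fun x₀ => ?_⟩, fun X => ?_⟩
  · refine ((ξ x₀).contMDiff x₀).congr_of_eventuallyEq ?_
    filter_upwards [hξ x₀] with y hy
    rw [dual_ext fun X => ((hξ y).self_of_nhds X).trans (hy X).symm]
  · ext x
    exact (hξ x).self_of_nhds X

variable (I F V) in
/-- The modules of sections of `V` and `V*` are in perfect duality. -/
theorem isPerfPair_pairingMap : (pairingMap I F V).IsPerfPair where
  bijective_left := by
    refine ⟨fun ξ η h => ?_, fun l => ?_⟩
    · ext1 x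
      exact dual_ext fun X => DFunLike.congr_fun (LinearMap.congr_fun h X) x
    · obtain ⟨ξ, hξ⟩ := exists_dualSection_of_functional l
      exact ⟨ξ, LinearMap.ext hξ⟩
  bijective_right := by
    refine ⟨fun X Y h => ?_, fun l => ?_⟩
    · ext1 x
      exact vector_ext fun ξ => DFunLike.congr_fun (LinearMap.congr_fun h ξ) x
    · obtain ⟨X, hX⟩ := exists_section_of_functional l
      exact ⟨X, LinearMap.ext hX⟩

variable (I F V) in
theorem isSplitting_canonicalForm : IsSplitting (canonicalForm I F V) (pairingMap I F V)
    (LinearMap.fst _ _ _) (LinearMap.snd _ _ _) where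
  perfect := isPerfPair_pairingMap I F V
  bijective := Function.bijective_id
  form _ _ := rfl

end Pairing

/-! ### Commuting elements under a derivation. -/

section Abstract

variable {R E : Type*} [CommRing R] [Algebra ℝ R] [AddCommGroup E] [Module R E]
  {B : LinearMap.BilinForm R E} {φ ψ : Word R E → R} {T : E → E}

/-- If two commuting elements are eigenvectors of the square of a derivation for the same
eigenvalue, then their derivatives commute. -/
theorem poisson_derivation_eq_zero (hB : B.SeparatingLeft) (hT : ∀ u v, B (T u) v = -B u (T v))
    (hφ : IsRegular B φ) (hψ : IsRegular B ψ) {c : ℝ}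
    (hφc : derivation T (derivation T φ) = c • φ) (hψc : derivation T (derivation T ψ) = c • ψ)
    (h : poisson B φ ψ = 0) : poisson B (derivation T φ) (derivation T ψ) = 0 := by
  -- The derivation is applied twice to `{φ, ψ} = 0`; the eigenvector terms vanish and twice the
  -- wanted bracket remains.
  have h1 := congrArg (derivation T) (derivation_poisson hB hT hφ hψ)
  rw [derivation_add, derivation_poisson hB hT (hφ.derivation hT) hψ,
    derivation_poisson hB hT hφ (hψ.derivation hT), h, derivation_zero, derivation_zero,
    hφc, hψc] at h1
  funext w
  have h2 := congrFun h1 w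
  have h3 := congrFun h w
  simp only [poisson, Pi.add_apply, Pi.zero_apply] at h2 h3 ⊢
  rw [poissonAt_smul_left hB w c hφ hψ, poissonAt_smul_right hB w c hφ hψ, h3, smul_zero,
    zero_add, add_zero, ← two_smul ℝ] at h2
  exact (smul_eq_zero.1 h2.symm).resolve_left two_ne_zero

/-- The sum of two commuting Courant algebroid structures. -/
theorem isCourantStructure_add (hB : B.SeparatingLeft) (hs : B.IsSymm)
    (hrep : ∀ l : E →ₗ[R] R, ∃ u, ∀ v, B u v = l v)
    (hφ : IsCourantStructure B φ) (hψ : IsCourantStructure B ψ) (h : poisson B φ ψ = 0) :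
    IsCourantStructure B (φ + ψ) := by
  have rφ := (hφ.1.isPoissonFn hrep).toIsRegular
  have rψ := (hψ.1.isPoissonFn hrep).toIsRegular
  refine ⟨hφ.1.add hψ.1, ?_⟩
  -- Graded symmetry makes the other mixed term vanish as well.
  have h' := poisson_comm hB hs rψ rφ hψ.1.parity_eq hφ.1.parity_eq
  rw [h, smul_zero] at h'
  funext w
  have h1 := congrFun hφ.2 w
  have h2 := congrFun hψ.2 w
  have h3 := congrFun h w
  have h4 := congrFun h' w
  simp only [poisson, Pi.zero_apply] at h1 h2 h3 h4 ⊢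
  rw [poissonAt_add_left hB w rφ rψ (rφ.add rψ), poissonAt_add_right hB w rφ rφ rψ,
    poissonAt_add_right hB w rψ rφ rψ, h1, h2, h3, h4]
  simp

end Abstract

/-! ### Translation from vector bundles to modules of sections. -/

section Algebroids

variable {EM : Type*} [NormedAddCommGroup EM] [NormedSpace ℝ EM]
  {H : Type*} [TopologicalSpace H] {I : ModelWithCorners ℝ EM H}
  {M : Type*} [TopologicalSpace M] [ChartedSpace H M]
  {F : Type*} [NormedAddCommGroup F] [NormedSpace ℝ F]
  {V : M → Type*} [TopologicalSpace (TotalSpace F V)]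
  [∀ x, AddCommGroup (V x)] [∀ x, Module ℝ (V x)] [∀ x, TopologicalSpace (V x)]
  [FiberBundle F V] [VectorBundle ℝ F V]

lemma algebraMap_smul_section (c : ℝ) (X : Cₛ^∞⟮I; F, V⟯) :
    algebraMap ℝ C^∞⟮I, M; ℝ⟯ c • X = c • X := by
  ext x
  rfl

section OnSections

variable [∀ x, IsTopologicalAddGroup (V x)] [∀ x, ContinuousSMul ℝ (V x)]

/-- A vector bundle endomorphism as an endomorphism of the module of sections. -/
noncomputable def onSectionsMap (N : BundleHom I F V F V) :
    Cₛ^∞⟮I; F, V⟯ →ₗ[C^∞⟮I, M; ℝ⟯] Cₛ^∞⟮I; F, V⟯ where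
  toFun := N.onSections
  map_add' X Y := by ext x; exact map_add (N x) (X x) (Y x)
  map_smul' f X := by ext x; exact map_smul (N x) (f x) (X x)

lemma pairing_negTranspose (N : BundleHom I F V F V) (ξ : DualSection I F V)
    (X : Cₛ^∞⟮I; F, V⟯) :
    pairing (N.negTranspose.onSections ξ) X = -pairing ξ (N.onSections X) := rfl

lemma smul_onSections (c : ℝ) (N : BundleHom I F V F V) (X : Cₛ^∞⟮I; F, V⟯) :
    BundleHom.onSections (c • N) X = c • N.onSections X := rfl

end OnSections

variable [IsManifold I ∞ M]

lemma mdifferentiableAt_function (f : C^∞⟮I, M; ℝ⟯) (x : M) : MDifferentiableAt I 𝓘(ℝ, ℝ) f x :=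
  (f.contMDiff x).mdifferentiableAt (by simp)

lemma AnchoredBracket.deriv_apply (D : AnchoredBracket I F V) (X : Cₛ^∞⟮I; F, V⟯)
    (f : C^∞⟮I, M; ℝ⟯) (x : M) : D.deriv X f x = mvfderiv I f x (D.anchor x (X x)) := rfl

/-- The anchor as a map to the derivations of the functions. -/
noncomputable def anchorMap (D : AnchoredBracket I F V) :
    Cₛ^∞⟮I; F, V⟯ →ₗ[C^∞⟮I, M; ℝ⟯] Derivation ℝ C^∞⟮I, M; ℝ⟯ C^∞⟮I, M; ℝ⟯ where
  toFun X := Derivation.mk'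
    { toFun := D.deriv X
      map_add' := fun f g => by
        ext x
        have := mvfderiv_add (mdifferentiableAt_function f x) (mdifferentiableAt_function g x)
        simp only [AnchoredBracket.deriv_apply, ContMDiffMap.coe_add, this, Pi.add_apply]
        rfl
      map_smul' := fun c f => by
        ext x
        have := mvfderiv_smul (mdifferentiableAt_const (I := I) (c := c) (x := x))
          (mdifferentiableAt_function f x)
        change mvfderiv I ((fun _ : M => c) • ⇑f) x _ = c • mvfderiv I f x _
        rw [this, mvfderiv_const]
        simp }
    (fun f g => by
      ext x
      have := mvfderiv_mul (mdifferentiableAt_function f x) (mdifferentiableAt_function g x)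
      change mvfderiv I (⇑f * ⇑g) x _ = f x * mvfderiv I g x _ + g x * mvfderiv I f x _
      rw [this]
      rfl)
  map_add' X Y := by
    ext f x
    change mvfderiv I f x (D.anchor x (X x + Y x)) = mvfderiv I f x _ + mvfderiv I f x _
    rw [map_add, map_add]
  map_smul' g X := by
    ext f x
    change mvfderiv I f x (D.anchor x (g x • X x)) = g x • mvfderiv I f x _
    rw [map_smul, map_smul]

lemma IsLieAlgebroid.isLieRinehart {D : AnchoredBracket I F V} (h : IsLieAlgebroid D) :
    IsLieRinehart D.bracket (anchorMap D) where
  add_left := h.add_left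
  skew := h.skew
  jacobi := h.jacobi
  leibniz := h.leibniz
  anchor_bracket := h.anchor_bracket

lemma IsLieRinehart.isLieAlgebroid {D : AnchoredBracket I F V}
    (h : IsLieRinehart D.bracket (anchorMap D)) : IsLieAlgebroid D where
  add_left := h.add_left
  smul_left c X Y := by
    rw [← algebraMap_smul_section, h.smul_left, algebraMap_smul_section]
  skew := h.skew
  jacobi := h.jacobi
  leibniz := h.leibniz
  anchor_bracket := h.anchor_bracket

variable [∀ x, IsTopologicalAddGroup (V x)] [∀ x, ContinuousSMul ℝ (V x)]

lemma deform_bracket (D : AnchoredBracket I F V) (N : BundleHom I F V F V) :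
    (D.deform N).bracket = deformBracket D.bracket (onSectionsMap N) := rfl

lemma anchorMap_deform (D : AnchoredBracket I F V) (N : BundleHom I F V F V) :
    anchorMap (D.deform N) = anchorMap D ∘ₗ onSectionsMap N := rfl

/-- Every term of the torsion contains the endomorphism twice, and the bracket is `ℝ`-bilinear. -/
lemma IsLieAlgebroid.torsion_smul {D : AnchoredBracket I F V} (h : IsLieAlgebroid D) (c : ℝ)
    (N : BundleHom I F V F V) (X Y : Cₛ^∞⟮I; F, V⟯) :
    torsion D (c • N) X Y = (c * c) • torsion D N X Y := by
  have smul_right : ∀ (c : ℝ) X Y, D.bracket X (c • Y) = c • D.bracket X Y := fun c X Y => by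
    rw [h.skew, h.smul_left, h.skew X Y, smul_neg]
  have map_smul' : ∀ X, N.onSections (c • X) = c • N.onSections X := fun X => by
    ext x; exact map_smul (N x) c (X x)
  have e : (D.deform (c • N)).bracket X Y = c • (D.deform N).bracket X Y := by
    simp only [AnchoredBracket.deform, smul_onSections, h.smul_left, smul_right, smul_add,
      smul_sub]
  rw [torsion, e, smul_onSections, smul_onSections, smul_onSections, h.smul_left, smul_right,
    map_smul', smul_smul, smul_smul, ← smul_sub]
  rfl

lemma IsLieAlgebroid.torsion_neg {D : AnchoredBracket I F V} (h : IsLieAlgebroid D)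
    (N : BundleHom I F V F V) (X Y : Cₛ^∞⟮I; F, V⟯) : torsion D N.neg X Y = torsion D N X Y := by
  have e : N.neg = (-1 : ℝ) • N := (neg_one_smul ℝ N).symm
  rw [e, h.torsion_smul]
  norm_num

/-- A multiple of a cps structure has vanishing torsion. -/
lemma IsProportionalToCps.torsion_eq_zero {D : AnchoredBracket I F V} (h : IsLieAlgebroid D)
    {N : BundleHom I F V F V} (hN : IsProportionalToCps D N) (X Y : Cₛ^∞⟮I; F, V⟯) :
    torsion D N X Y = 0 := by
  obtain ⟨c, N₀, hN₀, rfl⟩ := hN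
  rw [h.torsion_smul, hN₀.2, smul_zero]

/-- The square of a multiple of a cps structure is a multiple of the identity. -/
lemma IsProportionalToCps.exists_sq {D : AnchoredBracket I F V} {N : BundleHom I F V F V}
    (hN : IsProportionalToCps D N) :
    ∃ c : ℝ, ∀ X, N.onSections (N.onSections X) = algebraMap ℝ C^∞⟮I, M; ℝ⟯ c • X := by
  obtain ⟨c, N₀, ⟨⟨ε, -, hε⟩, -⟩, rfl⟩ := hN
  refine ⟨c * c * ε, fun X => ?_⟩
  rw [algebraMap_smul_section]
  ext x
  change c • N₀ x (c • N₀ x (X x)) = (c * c * ε) • X x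
  rw [map_smul, hε, smul_smul, smul_smul, mul_assoc]

lemma bracket_onSections {D : AnchoredBracket I F V} {N : BundleHom I F V F V}
    {X Y : Cₛ^∞⟮I; F, V⟯} (h : torsion D N X Y = 0) :
    D.bracket (onSectionsMap N X) (onSectionsMap N Y) =
      onSectionsMap N (deformBracket D.bracket (onSectionsMap N) X Y) :=
  sub_eq_zero.1 h

/-! ### The double -/

/-- The endomorphism `X + ξ ↦ N X - ᵗN ξ`. -/
noncomputable def tildeMap (N : BundleHom I F V F V) (u : DoubleSection I F V) :
    DoubleSection I F V :=
  (N.onSections u.1, N.negTranspose.onSections u.2)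

/-- The minus sign on the transpose gives the skew-symmetry that makes the induced operator a
derivation of the Poisson bracket. -/
lemma canonicalForm_tildeMap (N : BundleHom I F V F V) (u v : DoubleSection I F V) :
    canonicalForm I F V (tildeMap N u) v = -canonicalForm I F V u (tildeMap N v) := by
  change pairing (N.negTranspose.onSections u.2) v.1 + pairing v.2 (N.onSections u.1) =
    -(pairing u.2 (N.onSections v.1) + pairing (N.negTranspose.onSections v.2) u.1)
  rw [pairing_negTranspose, pairing_negTranspose]
  ring

lemma muFn_eq (D : AnchoredBracket I F V) : muFn D =
    algebroidFn D.bracket (fun X f => anchorMap D X f) (fun ξ X => pairingMap I F V ξ X)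
      (LinearMap.fst C^∞⟮I, M; ℝ⟯ _ _) (LinearMap.snd C^∞⟮I, M; ℝ⟯ _ _) := rfl

lemma gammaFn_eq (D' : AnchoredBracket I (F →L[ℝ] ℝ) (DualBundle V)) : gammaFn D' =
    algebroidFn D'.bracket (fun X f => anchorMap D' X f)
      (fun X ξ => (pairingMap I F V).flip X ξ)
      (LinearMap.snd C^∞⟮I, M; ℝ⟯ _ _) (LinearMap.fst C^∞⟮I, M; ℝ⟯ _ _) := rfl

lemma derivation_muFn (D : AnchoredBracket I F V) (N : BundleHom I F V F V) :
    derivation (tildeMap N) (muFn D) = muFn (D.deform N) := by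
  rw [muFn_eq, muFn_eq, deform_bracket, anchorMap_deform]
  exact derivation_algebroidFn (fun _ => rfl) fun _ _ => rfl

lemma derivation_gammaFn (D' : AnchoredBracket I (F →L[ℝ] ℝ) (DualBundle V))
    (N : BundleHom I F V F V) :
    derivation (tildeMap N) (gammaFn D') = gammaFn (D'.deform N.negTranspose) := by
  rw [gammaFn_eq, gammaFn_eq, deform_bracket, anchorMap_deform]
  refine derivation_algebroidFn (fun _ => rfl) fun u ξ => ?_
  change pairing ξ (N.onSections u.1) = -pairing (N.negTranspose.onSections ξ) u.1
  rw [pairing_negTranspose, neg_neg]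

lemma derivation_derivation_muFn {D : AnchoredBracket I F V} (h : IsLieAlgebroid D)
    {N : BundleHom I F V F V} (hN : ∀ X Y, torsion D N X Y = 0) {c : ℝ}
    (hc : ∀ X, N.onSections (N.onSections X) = algebraMap ℝ C^∞⟮I, M; ℝ⟯ c • X) :
    derivation (tildeMap N) (derivation (tildeMap N) (muFn D)) = c • muFn D := by
  rw [muFn_eq]
  exact derivation_derivation_algebroidFn h.isLieRinehart
    (fun X Y => bracket_onSections (hN X Y)) hc (fun _ => rfl) fun _ _ => rfl

lemma derivation_derivation_gammaFn {D' : AnchoredBracket I (F →L[ℝ] ℝ) (DualBundle V)}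
    (h : IsLieAlgebroid D') {N : BundleHom I F V F V}
    (hN : ∀ ξ η, torsion D' N.negTranspose ξ η = 0) {c : ℝ}
    (hc : ∀ ξ, N.negTranspose.onSections (N.negTranspose.onSections ξ) =
      algebraMap ℝ C^∞⟮I, M; ℝ⟯ c • ξ) :
    derivation (tildeMap N) (derivation (tildeMap N) (gammaFn D')) = c • gammaFn D' := by
  rw [gammaFn_eq]
  refine derivation_derivation_algebroidFn h.isLieRinehart
    (fun X Y => bracket_onSections (hN X Y)) hc (fun _ => rfl) fun u ξ => ?_
  change pairing ξ (N.onSections u.1) = -pairing (N.negTranspose.onSections ξ) u.1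
  rw [pairing_negTranspose, neg_neg]

lemma IsLieAlgebroid.deform {D : AnchoredBracket I F V} (h : IsLieAlgebroid D)
    {N : BundleHom I F V F V} (hN : ∀ X Y, torsion D N X Y = 0) : IsLieAlgebroid (D.deform N) :=
  IsLieRinehart.isLieAlgebroid
    (h.isLieRinehart.deform fun X Y => bracket_onSections (hN X Y))

/-- The signs cancel and transposition preserves scalars, so the constant on `V*` is the one on `V`.
This equality of eigenvalues is what the compatibility argument needs. -/
lemma negTranspose_sq {N : BundleHom I F V F V} {c : ℝ}
    (hc : ∀ X, N.onSections (N.onSections X) = algebraMap ℝ C^∞⟮I, M; ℝ⟯ c • X)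
    (hp : (pairingMap I F V).IsPerfPair) (ξ : DualSection I F V) :
    N.negTranspose.onSections (N.negTranspose.onSections ξ) =
      algebraMap ℝ C^∞⟮I, M; ℝ⟯ c • ξ := by
  refine hp.bijective_left.1 (LinearMap.ext fun X => ?_)
  rw [map_smul, LinearMap.smul_apply, pairingMap_apply, pairingMap_apply, pairing_negTranspose,
    pairing_negTranspose, neg_neg, hc, ← pairingMap_apply, map_smul]
  rfl

variable [FiniteDimensional ℝ EM] [T2Space M] [FiniteDimensional ℝ F]
  [ContMDiffVectorBundle ∞ F V I]

lemma IsLieAlgebroid.isCourantStructure_muFn {D : AnchoredBracket I F V}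
    (h : IsLieAlgebroid D) : IsCourantStructure (canonicalForm I F V) (muFn D) := by
  have hs := isSplitting_canonicalForm I F V
  rw [muFn_eq]
  exact ⟨h.isLieRinehart.isOfDegree hs, h.isLieRinehart.poisson_self hs⟩

lemma IsLieAlgebroid.isCourantStructure_gammaFn
    {D' : AnchoredBracket I (F →L[ℝ] ℝ) (DualBundle V)}
    (h : IsLieAlgebroid D') : IsCourantStructure (canonicalForm I F V) (gammaFn D') := by
  have hs := (isSplitting_canonicalForm I F V).symm
  rw [gammaFn_eq]
  exact ⟨h.isLieRinehart.isOfDegree hs, h.isLieRinehart.poisson_self hs⟩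

lemma poisson_tildeFn (N : BundleHom I F V F V) {φ : BigFunction I F V}
    (hφ : IsOfDegree (canonicalForm I F V) 3 φ) :
    poisson (canonicalForm I F V) (tildeFn N) φ = derivation (tildeMap N) φ := by
  have hs := isSplitting_canonicalForm I F V
  exact poisson_endoFn hs.separatingLeft hs.isSymm (hφ.isPoissonFn hs.representable)

end Algebroids

end LieBialgebroid

/-! ### The deformed Lie bialgebroid and its double. -/

theorem theorem4p5
    {EM : Type*} [NormedAddCommGroup EM] [NormedSpace ℝ EM] [FiniteDimensional ℝ EM]
    {H : Type*} [TopologicalSpace H] {I : ModelWithCorners ℝ EM H}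
    {M : Type*} [TopologicalSpace M] [ChartedSpace H M] [IsManifold I ∞ M]
    [BoundarylessManifold I M] [T2Space M] [SecondCountableTopology M]
    {F : Type*} [NormedAddCommGroup F] [NormedSpace ℝ F] [FiniteDimensional ℝ F]
    {A : M → Type*} [TopologicalSpace (TotalSpace F A)]
    [∀ x, AddCommGroup (A x)] [∀ x, Module ℝ (A x)] [∀ x, TopologicalSpace (A x)]
    [∀ x, IsTopologicalAddGroup (A x)] [∀ x, ContinuousSMul ℝ (A x)]
    [FiberBundle F A] [VectorBundle ℝ F A] [ContMDiffVectorBundle ∞ F A I]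
    (μ : AnchoredBracket I F A)
    (γ : AnchoredBracket I (F →L[ℝ] ℝ) (DualBundle A))
    (hμγ : IsLieBialgebroid μ γ)
    (N : BundleHom I F A F A)
    (hN : IsProportionalToCps μ N)
    (hNt : IsProportionalToCps γ N.transpose) :
    IsLieBialgebroid (μ.deform N) (γ.deform N.negTranspose) ∧
    muFn (μ.deform N) =
      poisson (canonicalForm I F A)
        (tildeFn N) (muFn μ) ∧
    gammaFn (γ.deform N.negTranspose) =
      poisson (canonicalForm I F A)
        (tildeFn N) (gammaFn γ) ∧
    double (μ.deform N) (γ.deform N.negTranspose) =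
      poisson (canonicalForm I F A)
        (tildeFn N) (double μ γ) ∧
    IsCourantStructure (canonicalForm I F A)
      (poisson (canonicalForm I F A)
        (tildeFn N) (double μ γ)) := by
  have hs := isSplitting_canonicalForm I F A
  have hB := hs.separatingLeft
  have tμ := hN.torsion_eq_zero hμγ.left
  -- Torsion is quadratic in the endomorphism, so the sign in `-ᵗN` does not affect it.
  have tγ : ∀ ξ η, torsion γ N.negTranspose ξ η = 0 := fun ξ η =>
    (hμγ.right.torsion_neg N.transpose ξ η).trans (hNt.torsion_eq_zero hμγ.right ξ η)
  obtain ⟨c, hc⟩ := hN.exists_sq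
  have hc' := negTranspose_sq hc hs.perfect
  have cμ := hμγ.left.isCourantStructure_muFn
  have cγ := hμγ.right.isCourantStructure_gammaFn
  have lμ := hμγ.left.deform tμ
  have lγ := hμγ.right.deform tγ
  have eμ := (poisson_tildeFn N cμ.1).trans (derivation_muFn μ N)
  have eγ := (poisson_tildeFn N cγ.1).trans (derivation_gammaFn γ N)
  have eD : poisson (canonicalForm I F A) (tildeFn N) (double μ γ) =
      double (μ.deform N) (γ.deform N.negTranspose) := by
    rw [double, poisson_tildeFn N (cμ.1.add cγ.1), derivation_add, derivation_muFn,
      derivation_gammaFn, double]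
  have hcomp : poisson (canonicalForm I F A) (muFn (μ.deform N))
      (gammaFn (γ.deform N.negTranspose)) = 0 := by
    rw [← derivation_muFn, ← derivation_gammaFn]
    exact poisson_derivation_eq_zero hB (canonicalForm_tildeMap N)
      (cμ.1.isPoissonFn hs.representable).toIsRegular
      (cγ.1.isPoissonFn hs.representable).toIsRegular
      (derivation_derivation_muFn hμγ.left tμ hc)
      (derivation_derivation_gammaFn hμγ.right tγ hc') hμγ.compatible
  refine ⟨⟨lμ, lγ, hcomp⟩, eμ.symm, eγ.symm, eD.symm, ?_⟩
  rw [eD]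
  exact isCourantStructure_add hB hs.isSymm hs.representable lμ.isCourantStructure_muFn
    lγ.isCourantStructure_gammaFn hcomp
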